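/- Fix an integer $b\ge 1$ and let $\omega=e^{2\pi i/b}$. Linear probing hashing with buckets of size $b$ on the cyclic table with buckets indexed by $\mathbb Z_m$: keys arrive one after another, and a key with hash address $i$ is stored in the first of the buckets $i,i+1,i+2,\dots$ (mod $m$) that is not full (contains fewer than $b$ keys). In the exact model with $m\ge1$ buckets and $n$ keys, all $m^n$ sequences of hash addresses are equally likely. For $n<bm$, let $U_{m,n}$ be the cost of an unsuccessful search starting at an arbitrary fixed bucket, i.e. the number of full buckets inspected before the first non-full bucket is reached, and let $u_{m,n}(q)=\sum_{k\ge0}\Pr(U_{m,n}=k)\,q^k$ be its probability generating function; put $u_{m,n}(q)=0$ for $n\ge bm$. Define $$U(z,w,q)=\sum_{m\ge1}\sum_{n\ge0}u_{m,n}(q)\,w^{bm}\frac{(mz)^n}{n!}.$$ Let $Q_{m,n,0}$ be the number of sequences of $n$ hash addresses for which the last bucket of the table with $m$ buckets is not full (with $Q_{0,0,0}=1$ and $Q_{0,n,0}=0$ for $n\ge1$), and for $i\ge0$, $0\le d\le b-1$, let $F_{bi+d}$ be the number of sequences of $bi+d$ hash addresses that give an almost full table with $i+1$ buckets (all buckets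 full except the last one, which contains $d$ keys). Put $$\Lambda_0(z,w)=\sum_{m\ge0}\sum_{n\ge0}Q_{m,n,0}\frac{z^n}{n!}w^{bm},\qquad F_d(u)=\sum_{i\ge0}F_{bi+d}\frac{u^{bi+d}}{(bi+d)!},\qquad N_0(z,w)=\sum_{d=0}^{b-1}w^{b-d}F_d(zw),$$ and let $T(x)=\sum_{n\ge1}\frac{n^{n-1}}{n!}x^n$ be the tree function. Then, as formal power series over $\mathbb C$ in $z$, $w$ and $q^{1/b}$ (quotients being taken in the field of fractions), $$U(bz,w,q)=\Lambda_0(bz,w)\,\frac{N_0(bz,w)-N_0(bz,wq^{1/b})}{1-q} =\frac{\prod_{j=0}^{b-1}\Bigl(1-\frac{T(\omega^j zwq^{1/b})}{z}\Bigr)-\prod_{j=0}^{b-1}\Bigl(1-\frac{T(\omega^j zw)}{z}\Bigr)}{(1-q)\prod_{j=0}^{b-1}\Bigl(1-\frac{T(\omega^j zw)}{z}\Bigr)} .$$ -/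

import Mathlib

open Finset

/-! ### Linear probing with buckets of size `b` on the cyclic table `ZMod m` -/

/-- Number of full buckets that a linear probe starting at bucket `a` inspects before it reaches the
first non-full bucket, in a table whose bucket `i` holds `c i` keys. -/
noncomputable def probeCost (b : ℕ) {m : ℕ} (c : ZMod m → ℕ) (a : ZMod m) : ℕ :=
  sInf {k : ℕ | c (a + (k : ZMod m)) < b}

/-- Insert a key with hash address `a`: it goes to the first non-full bucket among
`a, a + 1, a + 2, …` (cyclically). -/
noncomputable def insertKey (b : ℕ) {m : ℕ} (c : ZMod m → ℕ) (a : ZMod m) : ZMod m → ℕ :=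
  Function.update c (a + (probeCost b c a : ZMod m)) (c (a + (probeCost b c a : ZMod m)) + 1)

/-- Final bucket contents when keys with hash addresses `h 0, …, h (n - 1)` are inserted, one after
another, into an initially empty table. -/
noncomputable def hashTable (b : ℕ) {m n : ℕ} (h : Fin n → ZMod m) : ZMod m → ℕ :=
  (List.ofFn h).foldl (insertKey b) (fun _ => 0)

/-! ### Counting -/

/-- `F_n`: with `n = b * i + d`, `0 ≤ d < b`, the number of almost full tables with `i + 1` buckets
and `n` keys, that is, all buckets are full except the last one, which is not full.
The buckets are `0, …, i`, so the last bucket is `-1` modulo `i + 1`. -/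
noncomputable def almostFullCount (b n : ℕ) : ℕ :=
  Set.ncard {h : Fin n → ZMod (n / b + 1) |
    (∀ i : ZMod (n / b + 1), i ≠ -1 → b ≤ hashTable b h i) ∧ hashTable b h (-1) < b}

/-- `Q_{m,n,0}`: the number of ways of inserting `n` keys into a table with `m` buckets so that the
last bucket is not full; the empty table with no buckets is counted once. -/
noncomputable def lastNotFullCount (b m n : ℕ) : ℕ :=
  if m = 0 then (if n = 0 then 1 else 0)
  else Set.ncard {h : Fin n → ZMod m | hashTable b h (-1) < b}

/-- `P(U_{m,n} = k)` in the exact model (all `m ^ n` sequences of hash addresses equally likely),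
for an unsuccessful search that starts at bucket `a`; it is `0` by convention if `n ≥ b * m`. -/
noncomputable def unsuccProb (b m n : ℕ) (a : ZMod m) (k : ℕ) : ℝ :=
  if n < b * m then
    (Set.ncard {h : Fin n → ZMod m | probeCost b (hashTable b h) a = k} : ℝ) / (m : ℝ) ^ n
  else 0

/-! ### Generating functions, as formal power series over `ℂ` -/

/-- The tree function `T(x) = ∑_{n ≥ 1} n ^ (n - 1) x ^ n / n!`, evaluated at a formal power series
`x` without constant term. -/
noncomputable def treeFn {σ : Type*} (x : MvPowerSeries σ ℂ) : MvPowerSeries σ ℂ :=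
  PowerSeries.subst x
    (PowerSeries.mk fun n : ℕ =>
      if n = 0 then (0 : ℂ) else (n : ℂ) ^ (n - 1) / (n.factorial : ℂ))

/-- `F_d(x) = ∑_{i ≥ 0} F_{b i + d} x ^ (b i + d) / (b i + d)!`. -/
noncomputable def almostFullGF {σ : Type*} (b d : ℕ) (x : MvPowerSeries σ ℂ) :
    MvPowerSeries σ ℂ :=
  PowerSeries.subst x
    (PowerSeries.mk fun n : ℕ =>
      if n % b = d then (almostFullCount b n : ℂ) / (n.factorial : ℂ) else 0)

/-- `N_0(x, y) = ∑_{d < b} y ^ (b - d) F_d(x y)`, the generating function of almost full tables. -/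
noncomputable def clusterGF {σ : Type*} (b : ℕ) (x y : MvPowerSeries σ ℂ) : MvPowerSeries σ ℂ :=
  ∑ d ∈ range b, y ^ (b - d) * almostFullGF b d (x * y)

/-- `Λ_0(x, y) = ∑_{m ≥ 0} ∑_{n ≥ 0} Q_{m,n,0} x ^ n / n! y ^ (b m)`. -/
noncomputable def tableGF {σ : Type*} (b : ℕ) (x y : MvPowerSeries σ ℂ) : MvPowerSeries σ ℂ :=
  MvPowerSeries.subst ![x, y]
    (fun e : Fin 2 →₀ ℕ =>
      if b ∣ e 1 then (lastNotFullCount b (e 1 / b) (e 0) : ℂ) / ((e 0).factorial : ℂ) else 0 :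
      MvPowerSeries (Fin 2) ℂ)

/-- `U(x, y, r) = ∑_{m ≥ 1} ∑_{n ≥ 0} u_{m,n}(r) y ^ (b m) (m x) ^ n / n!`, where
`u_{m,n}(r) = ∑_k P(U_{m,n} = k) r ^ k` and, in the table with `m` buckets, the search starts at
bucket `a m`. -/
noncomputable def unsuccGF {σ : Type*} (b : ℕ) (a : (m : ℕ) → ZMod m)
    (x y r : MvPowerSeries σ ℂ) : MvPowerSeries σ ℂ :=
  MvPowerSeries.subst ![x, y, r]
    (fun e : Fin 3 →₀ ℕ =>
      if b ∣ e 1 ∧ 1 ≤ e 1 / b then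
        (unsuccProb b (e 1 / b) (e 0) (a (e 1 / b)) (e 2) : ℂ) *
          ((e 1 / b : ℕ) : ℂ) ^ (e 0) / ((e 0).factorial : ℂ)
      else 0 :
      MvPowerSeries (Fin 3) ℂ)

/-- The primitive root of unity `ω = exp(2πi/b)`. -/
noncomputable def omegaRoot (b : ℕ) : ℂ := Complex.exp (2 * Real.pi * Complex.I / b)

/-- Power series in the three formal variables `z`, `w` and `t = q^{1/b}`. -/
abbrev GFRing : Type := MvPowerSeries (Fin 3) ℂ

instance : IsDomain GFRing := NoZeroDivisors.to_isDomain GFRing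

/-- The field of fractions in which the quotients of power series are formed. -/
abbrev GFField : Type := FractionRing GFRing

/-- The variable `z`. -/
noncomputable def zVar : GFRing := MvPowerSeries.X 0

/-- The variable `w`. -/
noncomputable def wVar : GFRing := MvPowerSeries.X 1

/-- The variable `t = q^{1/b}`. -/
noncomputable def tVar : GFRing := MvPowerSeries.X 2

/-- A power series regarded as an element of the field of fractions. -/
noncomputable def toField (f : GFRing) : GFField := algebraMap GFRing GFField f

/-- `∏_{j=0}^{b-1} (1 - T(ω ^ j x) / z)`. -/
noncomputable def treeProd (b : ℕ) (x : GFRing) : GFField :=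
  ∏ j ∈ range b, (1 - toField (treeFn (omegaRoot b ^ j • x)) / toField zVar)

/-! ### Linear probing along a line -/

/-! The final table depends only on how many keys have each address. It is described by a flow: what
bucket `i` keeps plus what it passes on equals its own keys plus what it receives. If the last
bucket is open, nothing crosses the cut after it, so the cycle may be read as a line entered with
overflow zero (`exists_isFlow`, `load_last_lt_iff`, `endsOpen_iff`). Rotation turns a search of cost
`k` from any fixed bucket into one that stops in the last bucket, so `m ^ n / n!` times the
probability of cost `k` is a coefficient of `openGF b m k 0` (`unsuccProb_eq`).

A line whose last cell is open is cut after its first open cell; the piece cut off is an almost full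
table, and the rest starts with overflow zero (`openGF_eq_sum`). Summed over `m`, this renewal
equation gives `Λ₀ (1 - N₀) = 1`. When the `k` full cells before the end are marked by `q ^ k`, the
last cluster, with `m` cells, contributes `1 + q + ⋯ + q ^ (m - 1)`; hence `U (1 - N₀) (1 - q) =
N₀(w) - N₀(w q^{1/b})` (`tableGF_mul_one_sub`, `unsuccGF_mul_one_sub`).

For the product, let `ζ ^ b = 1` and `v = T(ζ u) / u`. From `T(x) = x exp T(x)` follows `v ^ b = exp
(b u v) = ∑ (b u) ^ k / k! * v ^ k`. If `v ^ s` stands for overflow `s`, this expands one cell of a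
line; iterating until the first open cell gives `v ^ b = ∑ F_d(b u) v ^ d` (`coeff_pow_add_eq`,
`pow_eq_sum_scaledAlmostFull`). The `b` choices of `ζ` give distinct roots, so the monic polynomial
`Y ^ b - ∑ F_d(b u) Y ^ d` splits (`cluster_polynomial_eq_prod`). At `u = z y`, `Y = 1 / y`, it
becomes `1 - N₀(b z, y) = ∏ (1 - T(ω ^ j z y) / z)` (`treeProd_eq`). -/

/-- Overflow into cell `j` when linear probing starts with overflow `s` and `x i` keys have
address `i`. -/
def overflow (b s : ℕ) (x : ℕ → ℕ) : ℕ → ℕ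
  | 0 => s
  | j + 1 => x j + overflow b s x j - b

/-- Number of keys that try to enter cell `j`. -/
def load (b s : ℕ) (x : ℕ → ℕ) (j : ℕ) : ℕ := x j + overflow b s x j

/-- In the line of `m` cells, the last cell is not full, and the `k` cells before it are full. -/
def EndsOpen (b m k s : ℕ) (x : ℕ → ℕ) : Prop :=
  k < m ∧ load b s x (m - 1) < b ∧ ∀ j < m - 1, m - 1 - k ≤ j → b ≤ load b s x j

lemma overflow_zero (b s : ℕ) (x : ℕ → ℕ) : overflow b s x 0 = s := rfl

lemma overflow_succ (b s : ℕ) (x : ℕ → ℕ) (j : ℕ) :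
    overflow b s x (j + 1) = load b s x j - b := rfl

lemma overflow_last {b s m : ℕ} {x : ℕ → ℕ} (hm : 0 < m) (h : load b s x (m - 1) < b) :
    overflow b s x m = 0 := by
  obtain ⟨n, rfl⟩ := Nat.exists_eq_succ_of_ne_zero hm.ne'
  exact Nat.sub_eq_zero_of_le h.le

lemma overflow_shift (b s : ℕ) (x : ℕ → ℕ) (j : ℕ) :
    overflow b s x (j + 1) = overflow b (x 0 + s - b) (fun i => x (i + 1)) j := by
  induction j with
  | zero => rfl
  | succ j ih => rw [overflow_succ, load, ih]; rfl

lemma load_zero (b s : ℕ) (x : ℕ → ℕ) : load b s x 0 = x 0 + s := rfl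

lemma load_shift (b s : ℕ) (x : ℕ → ℕ) (j : ℕ) :
    load b s x (j + 1) = load b (x 0 + s - b) (fun i => x (i + 1)) j := by
  rw [load, overflow_shift]; rfl

lemma load_congr {b s : ℕ} {x y : ℕ → ℕ} {j : ℕ} (h : ∀ i ≤ j, x i = y i) :
    load b s x j = load b s y j := by
  induction j with
  | zero => simp [load_zero, h]
  | succ j ih =>
    rw [load, load, overflow_succ, overflow_succ, ih (fun i hi => h i (by omega)), h _ le_rfl]

lemma EndsOpen.congr {b m k s : ℕ} {x y : ℕ → ℕ} (h : ∀ i < m, x i = y i)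
    (hx : EndsOpen b m k s x) : EndsOpen b m k s y := by
  obtain ⟨h1, h2, h3⟩ := hx
  refine ⟨h1, ?_, fun j hj hj' => ?_⟩
  · rwa [← load_congr fun i hi => h i (by omega)]
  · rw [← load_congr fun i hi => h i (by omega)]
    exact h3 j hj hj'

lemma endsOpen_congr {b m k s : ℕ} {x y : ℕ → ℕ} (h : ∀ i < m, x i = y i) :
    EndsOpen b m k s x ↔ EndsOpen b m k s y :=
  ⟨fun hx => hx.congr h, fun hy => hy.congr fun i hi => (h i hi).symm⟩

/-- Conservation of keys: a cell keeps the smaller of `b` and its load and passes on the excess. -/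
lemma sum_min_load (b s : ℕ) (x : ℕ → ℕ) (j : ℕ) :
    ∑ i ∈ range j, min b (load b s x i) + overflow b s x j = ∑ i ∈ range j, x i + s := by
  induction j with
  | zero => simp [overflow_zero]
  | succ j ih =>
    rw [sum_range_succ, sum_range_succ, overflow_succ]
    have : load b s x j = x j + overflow b s x j := rfl
    omega

/-! ### Flows in the cyclic table -/

/-- `c` is the table and `s i` the number of keys passing from bucket `i` to bucket `i + 1`, when
`x i` keys have hash address `i`. -/
structure IsFlow (b : ℕ) {m : ℕ} (x c s : ZMod m → ℕ) : Prop where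
  balance : ∀ i, c i + s i = x i + s (i - 1)
  le : ∀ i, c i ≤ b
  full : ∀ i, s i ≠ 0 → c i = b

section Table

variable {b m : ℕ}

lemma le_insertKey (c : ZMod m → ℕ) (a i : ZMod m) : c i ≤ insertKey b c a i := by
  unfold insertKey
  by_cases h : i = a + (probeCost b c a : ZMod m)
  · subst h; simp
  · rw [Function.update_of_ne h]

lemma le_foldl_insertKey (l : List (ZMod m)) (c : ZMod m → ℕ) (i : ZMod m) :
    c i ≤ l.foldl (insertKey b) c i := by
  induction l generalizing c with
  | nil => simp
  | cons a l ih => exact (le_insertKey c a i).trans (ih _)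

lemma le_of_lt_probeCost {c : ZMod m → ℕ} {a : ZMod m} {j : ℕ} (h : j < probeCost b c a) :
    b ≤ c (a + (j : ZMod m)) := by
  have := Nat.notMem_of_lt_sInf (s := {k : ℕ | c (a + (k : ZMod m)) < b}) h
  simpa using this

lemma IsFlow.eq_min {x c s : ZMod m → ℕ} (hf : IsFlow b x c s) (i : ZMod m) :
    c i = min b (x i + s (i - 1)) := by
  have h1 := hf.balance i
  have h2 := hf.le i
  have h3 := hf.full i
  by_cases h : s i = 0
  · omega
  · have := h3 h; omega

lemma IsFlow.out_eq {x c s : ZMod m → ℕ} (hf : IsFlow b x c s) (i : ZMod m) :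
    s i = x i + s (i - 1) - b := by
  have h1 := hf.balance i
  have := hf.eq_min i
  omega

/-- The cyclic table read as a line. -/
def unroll (x : ZMod m → ℕ) (j : ℕ) : ℕ := x (j : ZMod m)

/-- Both sides obey the same monotone recursion, and the line starts from zero, at most what enters
bucket `0` on the cycle. -/
lemma IsFlow.overflow_le {x c s : ZMod m → ℕ} (hf : IsFlow b x c s) (j : ℕ) :
    overflow b 0 (unroll x) j ≤ s ((j : ZMod m) - 1) := by
  induction j with
  | zero => simp [overflow_zero]
  | succ j ih =>
    rw [overflow_succ, load, unroll, Nat.cast_succ, add_sub_cancel_right, hf.out_eq]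
    omega

/-- An open last bucket passes nothing on, so cutting the cycle there loses no flow. -/
lemma IsFlow.overflow_eq {x c s : ZMod m → ℕ} (hf : IsFlow b x c s) (h : c (-1) < b) (j : ℕ) :
    overflow b 0 (unroll x) j = s ((j : ZMod m) - 1) := by
  induction j with
  | zero =>
    by_contra h0
    have := hf.full (-1) (by simpa [overflow_zero, eq_comm] using h0)
    omega
  | succ j ih =>
    rw [overflow_succ, load, unroll, Nat.cast_succ, add_sub_cancel_right, hf.out_eq, ih]

lemma IsFlow.eq_min_load {x c s : ZMod m → ℕ} (hf : IsFlow b x c s) (h : c (-1) < b) (j : ℕ) :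
    c (j : ZMod m) = min b (load b 0 (unroll x) j) := by
  rw [hf.eq_min, load, hf.overflow_eq h, unroll]

variable [NeZero m]

lemma sum_insertKey (c : ZMod m → ℕ) (a : ZMod m) :
    ∑ i, insertKey b c a i = ∑ i, c i + 1 := by
  classical
  unfold insertKey
  rw [Finset.sum_update_of_mem (mem_univ _), ← Finset.sum_sdiff (subset_univ {a + (probeCost b c a : ZMod m)})]
  simp; omega

lemma sum_foldl_insertKey (l : List (ZMod m)) (c : ZMod m → ℕ) :
    ∑ i, l.foldl (insertKey b) c i = ∑ i, c i + l.length := by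
  induction l generalizing c with
  | nil => simp
  | cons a l ih => simp [ih, sum_insertKey]; omega

lemma exists_open_of_sum_lt {c : ZMod m → ℕ} (h : ∑ i, c i < b * m) : ∃ i, c i < b := by
  by_contra! h'
  have := Finset.card_nsmul_le_sum univ c b (fun i _ => h' i)
  rw [card_univ, ZMod.card, smul_eq_mul, mul_comm] at this
  exact absurd h (not_lt.2 this)

lemma probeCost_spec {c : ZMod m → ℕ} (h : ∃ i, c i < b) (a : ZMod m) :
    c (a + (probeCost b c a : ZMod m)) < b := by
  obtain ⟨i, hi⟩ := h
  exact Nat.sInf_mem (s := {k : ℕ | c (a + (k : ZMod m)) < b})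
    ⟨(i - a).val, by simpa using hi⟩

lemma probeCost_lt {c : ZMod m → ℕ} (h : ∃ i, c i < b) (a : ZMod m) : probeCost b c a < m := by
  obtain ⟨i, hi⟩ := h
  exact (Nat.sInf_le (s := {k : ℕ | c (a + (k : ZMod m)) < b})
    (m := (i - a).val) (by simpa using hi)).trans_lt (ZMod.val_lt _)

lemma probeCost_eq_iff {c : ZMod m → ℕ} (h : ∃ i, c i < b) (a : ZMod m) (k : ℕ) :
    probeCost b c a = k ↔
      c (a + (k : ZMod m)) < b ∧ ∀ j < k, b ≤ c (a + (j : ZMod m)) := by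
  constructor
  · rintro rfl
    exact ⟨probeCost_spec h a, fun j hj => le_of_lt_probeCost hj⟩
  · rintro ⟨h1, h2⟩
    refine le_antisymm (Nat.sInf_le h1) ?_
    by_contra! hlt
    exact absurd (probeCost_spec h a) (not_lt.2 (h2 _ hlt))

lemma val_sub_one_of_ne_zero {x : ZMod m} (hx : x ≠ 0) : (x - 1).val = x.val - 1 := by
  have hpos : 0 < x.val := Nat.pos_of_ne_zero (by simpa [ZMod.val_eq_zero] using hx)
  have h : x - 1 = ((x.val - 1 : ℕ) : ZMod m) := by
    rw [Nat.cast_sub hpos]; simp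
  rw [h, ZMod.val_natCast_of_lt]
  have := ZMod.val_lt x
  omega

lemma val_neg_one_eq : (-1 : ZMod m).val = m - 1 := by
  obtain ⟨n, rfl⟩ := Nat.exists_eq_succ_of_ne_zero (NeZero.ne m)
  exact ZMod.val_neg_one n

/-- The new key adds one unit of flow out of exactly the full buckets it passes, those at offset
less than the probe cost from `a`. -/
lemma IsFlow.insertKey {x c s : ZMod m → ℕ} (hf : IsFlow b x c s) (h : ∃ i, c i < b)
    (a : ZMod m) :
    IsFlow b (fun i => x i + if i = a then 1 else 0) (insertKey b c a)
      (fun i => s i + if (i - a).val < probeCost b c a then 1 else 0) := by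
  have hk := probeCost_lt h a
  have hspec := probeCost_spec h a
  have hlt := fun j => le_of_lt_probeCost (b := b) (c := c) (a := a) (j := j)
  generalize hkk : probeCost b c a = k at hk hspec hlt
  have hval : ∀ i : ZMod m, i = a + (k : ZMod m) ↔ (i - a).val = k := by
    intro i
    constructor
    · rintro rfl
      rw [add_sub_cancel_left, ZMod.val_natCast_of_lt hk]
    · intro hi
      rw [← hi]; simp
  have hins : ∀ i, _root_.insertKey b c a i = c i + if (i - a).val = k then 1 else 0 := by
    intro i
    unfold _root_.insertKey
    rw [hkk]
    by_cases hi : i = a + (k : ZMod m)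
    · rw [if_pos ((hval i).1 hi)]; subst hi; simp
    · rw [Function.update_of_ne hi, if_neg (fun h' => hi ((hval i).2 h'))]; rfl
  refine ⟨fun i => ?_, fun i => ?_, fun i => ?_⟩
  · rw [hins]
    have hb := hf.balance i
    have hia : i - 1 - a = (i - a) - 1 := by ring
    -- The predecessor of `a` has offset `m - 1`, which is not below the probe cost since that is
    -- below `m`: the new key never goes all the way round.
    by_cases hi : i = a
    · subst hi
      rw [hia]
      simp only [sub_self, ZMod.val_zero, zero_sub, val_neg_one_eq, if_true]
      split_ifs <;> omega
    · have hne : i - a ≠ 0 := sub_ne_zero.2 hi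
      have hpos : 0 < (i - a).val :=
        Nat.pos_of_ne_zero (by simpa [ZMod.val_eq_zero] using hne)
      rw [hia, val_sub_one_of_ne_zero hne, if_neg hi]
      split_ifs <;> omega
  · rw [hins]
    split_ifs with hi
    · rw [← hval] at hi
      subst hi
      omega
    · simpa using hf.le i
  · rw [hins]
    intro hne
    by_cases hi : (i - a).val < k
    · rw [if_neg hi.ne]
      have h1 := hlt _ hi
      simp only [ZMod.natCast_val, ZMod.cast_id', id_eq, add_sub_cancel] at h1
      have h2 := hf.le i
      omega
    · have hs : s i ≠ 0 := by simpa [hi] using hne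
      have hc := hf.full i hs
      rw [if_neg, hc, add_zero]
      intro hik
      rw [← hval] at hik
      subst hik
      omega

/-- The length bound leaves an open bucket before each insertion, so `IsFlow.insertKey` applies key
by key. -/
lemma exists_isFlow (l : List (ZMod m)) (hl : l.length ≤ b * m) :
    ∃ s, IsFlow b (fun i => l.count i) (l.foldl (insertKey b) (fun _ => 0)) s := by
  induction l using List.reverseRecOn with
  | nil => exact ⟨fun _ => 0, by simp, by simp, by simp⟩
  | append_singleton l a ih =>
    simp only [List.length_append, List.length_singleton] at hl
    obtain ⟨s, hs⟩ := ih (by omega)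
    have hopen : ∃ i, l.foldl (insertKey b) (fun _ => 0) i < b := by
      apply exists_open_of_sum_lt
      rw [sum_foldl_insertKey, sum_const_zero]
      omega
    refine ⟨fun i => s i + if (i - a).val < probeCost b (l.foldl (insertKey b) fun _ => 0) a
      then 1 else 0, ?_⟩
    rw [List.foldl_append, List.foldl_cons, List.foldl_nil]
    convert hs.insertKey hopen a using 2 with i
    rw [List.count_append, List.count_singleton]
    simp only [beq_iff_eq, eq_comm (a := i)]

/-- The first `b * m` keys fill the table. Afterwards the probe cost is the infimum of the empty
set, namely `0`, so further keys pile up at their own addresses and no bucket reopens. -/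
lemma le_hashTable_of_length (l : List (ZMod m)) (hl : b * m ≤ l.length) (i : ZMod m) :
    b ≤ l.foldl (insertKey b) (fun _ => 0) i := by
  rw [← List.take_append_drop (b * m) l, List.foldl_append]
  refine le_trans ?_ (le_foldl_insertKey _ _ i)
  have hlen : (l.take (b * m)).length = b * m := by simp [hl]
  obtain ⟨s, hs⟩ := exists_isFlow (l.take (b * m)) hlen.le
  by_contra! hlt
  have hsum := sum_foldl_insertKey (b := b) (l.take (b * m)) (fun _ => 0)
  rw [hlen] at hsum
  have h2 := Finset.sum_lt_sum (s := univ) (fun i _ => hs.le i) ⟨i, mem_univ _, hlt⟩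
  rw [sum_const, card_univ, ZMod.card, smul_eq_mul, hsum, mul_comm, sum_const_zero, zero_add] at h2
  exact lt_irrefl _ h2

lemma sum_range_unroll (x : ZMod m → ℕ) : ∑ j ∈ range m, unroll x j = ∑ i, x i := by
  refine Finset.sum_nbij' (fun j => (j : ZMod m)) (fun i => i.val) ?_ ?_ ?_ ?_ ?_
  · simp
  · intro i _; simpa using ZMod.val_lt i
  · intro j hj; simpa using ZMod.val_natCast_of_lt (by simpa using hj)
  · intro i _; simp
  · intro j _; rfl

lemma cast_pred_eq : ((m - 1 : ℕ) : ZMod m) = -1 := by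
  rw [Nat.cast_sub (Nat.pos_of_ne_zero (NeZero.ne m))]; simp

/-- With no final overflow the line stores every key, as the cycle does. But each line cell holds at
most what the cyclic bucket holds, and strictly less at the end if the cyclic bucket were full
there. -/
lemma IsFlow.last_lt_of_load {x c s : ZMod m → ℕ} (hf : IsFlow b x c s)
    (h : load b 0 (unroll x) (m - 1) < b) : c (-1) < b := by
  by_contra! hc
  have hm : 0 < m := Nat.pos_of_ne_zero (NeZero.ne m)
  have hsum : ∑ i, c i = ∑ i, x i := by
    have h1 : ∑ i, (c i + s i) = ∑ i, (x i + s (i - 1)) := sum_congr rfl fun i _ => hf.balance i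
    have h2 : ∑ i, s (i - 1) = ∑ i, s i := Equiv.sum_comp (Equiv.subRight (1 : ZMod m)) s
    rw [sum_add_distrib, sum_add_distrib] at h1
    omega
  have h2 := sum_min_load b 0 (unroll x) m
  have h3 : overflow b 0 (unroll x) m = 0 := overflow_last hm h
  have h4 : ∑ i ∈ range m, min b (load b 0 (unroll x) i) < ∑ i ∈ range m, unroll c i := by
    refine sum_lt_sum (fun j _ => ?_) ⟨m - 1, by simp [hm], ?_⟩
    · rw [unroll, hf.eq_min, load, unroll]
      have := hf.overflow_le j
      omega
    · rw [unroll, cast_pred_eq]; omega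
  rw [sum_range_unroll] at h2 h4
  omega

/-- With at least `b * m` keys both sides fail: the cyclic table is full, and a line that ends open
stores fewer than `b * m` keys. -/
lemma load_last_lt_iff (l : List (ZMod m)) :
    l.foldl (insertKey b) (fun _ => 0) (-1) < b ↔
      load b 0 (unroll fun i => l.count i) (m - 1) < b := by
  rcases lt_or_ge l.length (b * m) with hl | hl
  · obtain ⟨s, hs⟩ := exists_isFlow l hl.le
    refine ⟨fun h => ?_, hs.last_lt_of_load⟩
    have := hs.eq_min_load h (m - 1)
    rw [cast_pred_eq] at this
    omega
  · refine ⟨fun h => absurd (le_hashTable_of_length l hl (-1)) (by omega), fun h => ?_⟩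
    exfalso
    have hm : 0 < m := Nat.pos_of_ne_zero (NeZero.ne m)
    have h2 := sum_min_load b 0 (unroll fun i => l.count i) m
    have h3 : ∑ i ∈ range m, min b (load b 0 (unroll fun i => l.count i) i) < ∑ i ∈ range m, b :=
      sum_lt_sum (fun j _ => min_le_left _ _) ⟨m - 1, by simp [hm], (min_le_right _ _).trans_lt h⟩
    have h4 : ∑ i, l.count i = l.length := by
      simpa using (Multiset.sum_count_eq_card (s := univ) (m := (l : Multiset (ZMod m)))
        (fun a _ => mem_univ a))
    rw [sum_range_unroll, h4, overflow_last hm h] at h2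
    rw [sum_const, card_range, smul_eq_mul, mul_comm] at h3
    omega

lemma endsOpen_iff (l : List (ZMod m)) (k : ℕ) (hk : k < m) :
    EndsOpen b m k 0 (unroll fun i => l.count i) ↔
      l.foldl (insertKey b) (fun _ => 0) (-1) < b ∧
        ∀ j < m - 1, m - 1 - k ≤ j → b ≤ l.foldl (insertKey b) (fun _ => 0) (j : ZMod m) := by
  unfold EndsOpen
  rw [load_last_lt_iff]
  simp only [hk, true_and]
  refine and_congr_right fun h => ?_
  have h' := (load_last_lt_iff l).2 h
  have hl : l.length < b * m := by
    by_contra! hl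
    exact absurd (le_hashTable_of_length l hl (-1)) (by omega)
  obtain ⟨s, hs⟩ := exists_isFlow l hl.le
  refine forall_congr' fun j => ?_
  rw [hs.eq_min_load h' j]
  simp

end Table

/-! ### Counting hash sequences by the numbers of keys per address -/

/-- The sequence `k, x 0, x 1, …`. -/
def natCons (k : ℕ) (x : ℕ → ℕ) : ℕ → ℕ
  | 0 => k
  | j + 1 => x j

/-- The sum of `f x / ∏ i, (x i)!` over `x 0 + ⋯ + x (m - 1) = n`, where `x i = 0` for `i ≥ m`. -/
noncomputable def weightSum : ℕ → ℕ → ((ℕ → ℕ) → ℂ) → ℂ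
  | 0, n, f => if n = 0 then f 0 else 0
  | m + 1, n, f => ∑ p ∈ antidiagonal n,
      ((p.1.factorial : ℂ))⁻¹ * weightSum m p.2 fun x => f (natCons p.1 x)

lemma natCons_zero_zero : natCons 0 0 = 0 := by
  funext j; cases j <;> rfl

lemma weightSum_zero_right (m : ℕ) (f : (ℕ → ℕ) → ℂ) : weightSum m 0 f = f 0 := by
  induction m generalizing f with
  | zero => simp [weightSum]
  | succ m ih => simp [weightSum, ih, natCons_zero_zero]

lemma natCons_add_single_zero (k : ℕ) (x : ℕ → ℕ) :
    natCons k x + Pi.single 0 1 = natCons (k + 1) x := by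
  funext j; cases j <;> simp [natCons]

lemma natCons_add_single_succ (k i : ℕ) (x : ℕ → ℕ) :
    natCons k x + Pi.single (i + 1) 1 = natCons k (x + Pi.single i 1) := by
  funext j; cases j <;> simp [natCons, Pi.single_apply]

/-- Since `1 / (x i - 1)! = x i / x i!`, the left side weights each `x` of total `n + 1` by `∑ x i =
n + 1`. -/
lemma sum_weightSum_add_single (m n : ℕ) (f : (ℕ → ℕ) → ℂ) :
    ∑ i ∈ range m, weightSum m n (fun x => f (x + Pi.single i 1)) =
      (n + 1 : ℂ) * weightSum m (n + 1) f := by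
  induction m generalizing n f with
  | zero => simp [weightSum]
  | succ m ih =>
    rw [sum_range_succ']
    simp only [weightSum, natCons_add_single_zero, natCons_add_single_succ]
    rw [sum_comm]
    have h0 : ∀ p : ℕ × ℕ, ∑ i ∈ range m,
        weightSum m p.2 (fun x => f (natCons p.1 (x + Pi.single i 1))) = _ :=
      fun p => ih p.2 fun x => f (natCons p.1 x)
    simp_rw [← mul_sum, h0]
    have h1 : ∑ p ∈ antidiagonal n, ((p.1.factorial : ℂ))⁻¹ *
        (((p.2 : ℂ) + 1) * weightSum m (p.2 + 1) fun x => f (natCons p.1 x)) =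
        ∑ p ∈ antidiagonal (n + 1), (p.2 : ℂ) * (((p.1.factorial : ℂ))⁻¹ *
          weightSum m p.2 fun x => f (natCons p.1 x)) := by
      rw [Nat.sum_antidiagonal_succ']
      simp only [Nat.cast_zero, zero_mul, zero_add, Nat.cast_succ]
      exact sum_congr rfl fun p _ => by ring
    have h2 : ∑ p ∈ antidiagonal n, ((p.1.factorial : ℂ))⁻¹ *
        (weightSum m p.2 fun x => f (natCons (p.1 + 1) x)) =
        ∑ p ∈ antidiagonal (n + 1), (p.1 : ℂ) * (((p.1.factorial : ℂ))⁻¹ *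
          weightSum m p.2 fun x => f (natCons p.1 x)) := by
      rw [Nat.sum_antidiagonal_succ]
      simp only [Nat.cast_zero, zero_mul, zero_add, Nat.cast_succ]
      refine sum_congr rfl fun p _ => ?_
      have h : (p.1 + 1 : ℂ) ≠ 0 := by exact_mod_cast Nat.succ_ne_zero p.1
      have h' : (p.1.factorial : ℂ) ≠ 0 := by exact_mod_cast Nat.factorial_ne_zero p.1
      rw [Nat.factorial_succ]; push_cast
      field_simp
    rw [h1, h2, ← sum_add_distrib, mul_sum]
    refine sum_congr rfl fun p hp => ?_
    rw [← add_mul]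
    have : (n + 1 : ℂ) = p.2 + p.1 := by
      have := mem_antidiagonal.1 hp
      exact_mod_cast (by omega)
    rw [this]

lemma sum_zmod_val {m : ℕ} [NeZero m] (g : ℕ → ℂ) :
    ∑ i : ZMod m, g i.val = ∑ i ∈ range m, g i := by
  refine sum_nbij' (fun i => i.val) (fun j => (j : ZMod m)) ?_ ?_ ?_ ?_ ?_
  · intro i _; simpa using ZMod.val_lt i
  · simp
  · intro i _; simp
  · intro j hj; simpa using ZMod.val_natCast_of_lt (by simpa using hj)
  · intro i _; rfl

/-- Multinomial counting, by induction on the keys: the first key adds one to the count at its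
address, and `sum_weightSum_add_single` sums over that address. -/
lemma sum_hash_eq {m : ℕ} [NeZero m] (n : ℕ) (f : (ℕ → ℕ) → ℂ) :
    ∑ h : Fin n → ZMod m, f (fun j => (List.ofFn fun t => (h t).val).count j) =
      (n.factorial : ℂ) * weightSum m n f := by
  induction n generalizing f with
  | zero =>
    simp [weightSum_zero_right]
    rfl
  | succ n ih =>
    rw [← (Fin.consEquiv fun _ => ZMod m).sum_comp, Fintype.sum_prod_type]
    have h1 : ∀ (i : ZMod m) (h : Fin n → ZMod m),
        (fun j => (List.ofFn fun t => ((Fin.consEquiv fun _ => ZMod m) (i, h) t).val).count j) =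
        (fun j => (List.ofFn fun t => (h t).val).count j) + Pi.single i.val 1 := by
      intro i h
      funext j
      simp [Fin.consEquiv, List.ofFn_succ, List.count_cons, Pi.single_apply, eq_comm (a := j)]
    have h0 : ∀ i : ZMod m, ∑ h : Fin n → ZMod m, f ((fun j =>
        (List.ofFn fun t => (h t).val).count j) + Pi.single i.val 1) = _ :=
      fun i => ih fun x => f (x + Pi.single i.val 1)
    simp_rw [h1, h0, ← mul_sum]
    refine (congrArg ((n.factorial : ℂ) * ·) (sum_zmod_val (m := m) fun i =>
      weightSum m n fun x => f (x + Pi.single i 1))).trans ?_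
    rw [sum_weightSum_add_single, Nat.factorial_succ]
    push_cast
    ring

lemma weightSum_congr {m n : ℕ} {f g : (ℕ → ℕ) → ℂ} (h : ∀ x, f x = g x) :
    weightSum m n f = weightSum m n g := by
  rw [funext h]

lemma ncard_hash_eq {m : ℕ} [NeZero m] (n : ℕ) (P : (ℕ → ℕ) → Prop) [DecidablePred P] :
    (Set.ncard {h : Fin n → ZMod m | P fun j => (List.ofFn fun t => (h t).val).count j} : ℂ) =
      (n.factorial : ℂ) * weightSum m n fun x => if P x then 1 else 0 := by
  classical
  rw [← sum_hash_eq, Finset.sum_boole, Set.ncard_eq_toFinset_card']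
  simp

open Classical in
/-- Exponential generating function of the address counts for which probing along a line of `m`
cells, starting with overflow `s`, leaves the last cell open after `k` full ones. -/
noncomputable def openGF (b m k s : ℕ) : PowerSeries ℂ :=
  PowerSeries.mk fun n => weightSum m n fun x => if EndsOpen b m k s x then 1 else 0

lemma unroll_count_eq {m : ℕ} [NeZero m] {n : ℕ} (h : Fin n → ZMod m) {j : ℕ} (hj : j < m) :
    unroll (fun i => (List.ofFn h).count i) j = (List.ofFn fun t => (h t).val).count j := by
  have h1 : (List.ofFn fun t => (h t).val) = (List.ofFn h).map ZMod.val := by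
    rw [List.map_ofFn]; rfl
  have h2 : j = ((j : ZMod m)).val := (ZMod.val_natCast_of_lt hj).symm
  rw [h1]
  conv_rhs => rw [h2]
  rw [List.count_map_of_injective _ _ (ZMod.val_injective m)]
  rfl

lemma ncard_table_eq {m : ℕ} [NeZero m] (b n k : ℕ) (hk : k < m) :
    (Set.ncard {h : Fin n → ZMod m | hashTable b h (-1) < b ∧
      ∀ j < m - 1, m - 1 - k ≤ j → b ≤ hashTable b h (j : ZMod m)} : ℂ) =
      (n.factorial : ℂ) * PowerSeries.coeff n (openGF b m k 0) := by
  classical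
  rw [openGF, PowerSeries.coeff_mk, ← ncard_hash_eq]
  congr 3
  ext h
  rw [hashTable, ← endsOpen_iff _ _ hk]
  exact endsOpen_congr fun i hi => unroll_count_eq h hi

lemma lastNotFullCount_eq (b m n : ℕ) (hm : 0 < m) :
    (lastNotFullCount b m n : ℂ) = (n.factorial : ℂ) * PowerSeries.coeff n (openGF b m 0 0) := by
  have : NeZero m := ⟨hm.ne'⟩
  rw [← ncard_table_eq b n 0 hm, lastNotFullCount, if_neg hm.ne']
  congr 3
  ext h
  refine (and_iff_left ?_).symm
  intro j h1 h2
  omega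

lemma almostFullCount_eq (b n : ℕ) :
    (almostFullCount b n : ℂ) =
      (n.factorial : ℂ) * PowerSeries.coeff n (openGF b (n / b + 1) (n / b) 0) := by
  rw [← ncard_table_eq b n _ (Nat.lt_succ_self _), almostFullCount]
  congr 3
  ext h
  rw [and_comm]
  refine and_congr_right fun _ => ⟨fun H j hj _ => H _ ?_, fun H i hi => ?_⟩
  · intro h1
    have h2 := congrArg ZMod.val h1
    rw [ZMod.val_natCast_of_lt (by omega), ZMod.val_neg_one] at h2
    omega
  · have h1 := H i.val ?_ (by omega)
    · simpa using h1
    · have h2 := ZMod.val_lt i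
      have h3 : i.val ≠ n / b := by
        intro h4
        apply hi
        apply ZMod.val_injective
        rw [h4, ZMod.val_neg_one]
      omega

/-! ### Rotation invariance and the distribution of the search cost -/

section Rotation

variable {b m : ℕ}

lemma probeCost_rotate (c : ZMod m → ℕ) (a r : ZMod m) :
    probeCost b (fun i => c (i - r)) (a + r) = probeCost b c a := by
  unfold probeCost
  congr 1
  ext k
  simp only [Set.mem_ofPred_eq]
  rw [show a + r + (k : ZMod m) - r = a + k by ring]

lemma insertKey_rotate (c : ZMod m → ℕ) (a r : ZMod m) :
    insertKey b (fun i => c (i - r)) (a + r) = fun i => insertKey b c a (i - r) := by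
  unfold insertKey
  rw [probeCost_rotate]
  funext i
  simp only [Function.update_apply]
  have h : i = a + r + (probeCost b c a : ZMod m) ↔ i - r = a + (probeCost b c a : ZMod m) := by
    rw [sub_eq_iff_eq_add, add_right_comm]
  simp only [h, show a + r + (probeCost b c a : ZMod m) - r = a + (probeCost b c a : ZMod m) by ring]

lemma foldl_insertKey_rotate (l : List (ZMod m)) (c : ZMod m → ℕ) (r : ZMod m) :
    (l.map (· + r)).foldl (insertKey b) (fun i => c (i - r)) =
      fun i => l.foldl (insertKey b) c (i - r) := by
  induction l generalizing c with
  | nil => rfl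
  | cons a l ih => rw [List.map_cons, List.foldl_cons, insertKey_rotate, ih, List.foldl_cons]

lemma hashTable_rotate {n : ℕ} (h : Fin n → ZMod m) (r : ZMod m) :
    hashTable b (fun t => h t + r) = fun i => hashTable b h (i - r) := by
  unfold hashTable
  rw [← foldl_insertKey_rotate, List.map_ofFn]
  rfl

lemma ncard_probeCost_rotate (n : ℕ) (a a' : ZMod m) (k : ℕ) :
    Set.ncard {h : Fin n → ZMod m | probeCost b (hashTable b h) a = k} =
      Set.ncard {h : Fin n → ZMod m | probeCost b (hashTable b h) a' = k} := by
  refine Set.ncard_congr (fun h _ t => h t + (a' - a)) ?_ ?_ ?_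
  · intro h hh
    simp only [Set.mem_ofPred_eq] at hh ⊢
    rw [hashTable_rotate, ← hh, ← probeCost_rotate (hashTable b h) a (a' - a)]
    congr 1; ring
  · intro h h' _ _ heq
    funext t
    simpa using congrFun heq t
  · intro h hh
    simp only [Set.mem_ofPred_eq] at hh
    refine ⟨fun t => h t + (a - a'), ?_, by funext t; ring⟩
    simp only [Set.mem_ofPred_eq]
    rw [hashTable_rotate, ← hh, ← probeCost_rotate (hashTable b h) a' (a - a')]
    congr 1; ring

lemma sum_hashTable [NeZero m] {n : ℕ} (h : Fin n → ZMod m) : ∑ i, hashTable b h i = n := by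
  simp [hashTable, sum_foldl_insertKey]

lemma unsuccProb_eq (b m n : ℕ) [NeZero m] (a : ZMod m) (k : ℕ) :
    (unsuccProb b m n a k : ℂ) * (m : ℂ) ^ n =
      (n.factorial : ℂ) * PowerSeries.coeff n (openGF b m k 0) := by
  have hm : 0 < m := Nat.pos_of_ne_zero (NeZero.ne m)
  have hm' : (m : ℂ) ≠ 0 := by exact_mod_cast hm.ne'
  rcases lt_or_ge k m with hk | hk
  · rw [← ncard_table_eq b n k hk, unsuccProb]
    split_ifs with hn
    · push_cast
      -- Starting at `-1 - k`, a search of cost `k` stops exactly in the last bucket.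
      rw [div_mul_cancel₀ _ (pow_ne_zero _ hm'), ncard_probeCost_rotate n a (-1 - k)]
      congr 2
      ext h
      simp only [Set.mem_ofPred_eq]
      rw [probeCost_eq_iff (exists_open_of_sum_lt (by rwa [sum_hashTable]))]
      rw [show (-1 - k + k : ZMod m) = -1 by ring]
      have hcast : ((m - 1 - k : ℕ) : ZMod m) = -1 - k := by
        rw [Nat.cast_sub (by omega), cast_pred_eq]
      refine and_congr_right fun _ => ⟨fun H j h1 h2 => ?_, fun H j hj => ?_⟩
      · have := H (j - (m - 1 - k)) (by omega)
        rw [← hcast, ← Nat.cast_add] at this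
        rwa [show m - 1 - k + (j - (m - 1 - k)) = j by omega] at this
      · have := H (m - 1 - k + j) (by omega) (by omega)
        rwa [Nat.cast_add, hcast] at this
    · rw [Complex.ofReal_zero, zero_mul, eq_comm, Nat.cast_eq_zero, Set.ncard_eq_zero]
      ext h
      simp only [Set.mem_ofPred_eq, Set.mem_empty_iff_false, iff_false, not_and]
      intro h1
      exact absurd (le_hashTable_of_length (List.ofFn h) (by simpa using hn) (-1)) (not_le.2 h1)
  -- For `k ≥ m` both sides vanish: a search in a table with an open bucket costs less than `m`.
  · have h1 : PowerSeries.coeff n (openGF b m k 0) = 0 := by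
      have : ∀ f : (ℕ → ℕ) → ℂ, f = (fun _ => 0) → weightSum m n f = 0 := by
        rintro f rfl
        have h := sum_hash_eq (m := m) n fun _ => 0
        rw [sum_const_zero, eq_comm, mul_eq_zero] at h
        exact h.resolve_left (by exact_mod_cast n.factorial_ne_zero)
      rw [openGF, PowerSeries.coeff_mk]
      exact this _ (funext fun x => if_neg fun hx => absurd hx.1 (by omega))
    rw [h1, mul_zero, unsuccProb]
    split_ifs with hn
    · have : {h : Fin n → ZMod m | probeCost b (hashTable b h) a = k} = ∅ := by
        ext h
        simp only [Set.mem_ofPred_eq, Set.mem_empty_iff_false, iff_false]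
        have := probeCost_lt (exists_open_of_sum_lt (b := b) (c := hashTable b h)
          (by rwa [sum_hashTable])) a
        omega
      rw [this]; simp
    · simp

end Rotation

/-! ### Decomposition of a table into clusters -/

/-- Adds a first cell to a line: `∑ k, X ^ k / k! * g k`. -/
noncomputable def firstCell (g : ℕ → PowerSeries ℂ) : PowerSeries ℂ :=
  PowerSeries.mk fun n => ∑ p ∈ antidiagonal n,
    ((p.1.factorial : ℂ))⁻¹ * PowerSeries.coeff p.2 (g p.1)

lemma coeff_firstCell (g : ℕ → PowerSeries ℂ) (n : ℕ) :
    PowerSeries.coeff n (firstCell g) = ∑ p ∈ antidiagonal n,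
      ((p.1.factorial : ℂ))⁻¹ * PowerSeries.coeff p.2 (g p.1) := PowerSeries.coeff_mk _ _

lemma firstCell_add (g h : ℕ → PowerSeries ℂ) :
    firstCell (fun k => g k + h k) = firstCell g + firstCell h := by
  ext n
  simp [coeff_firstCell, mul_add, sum_add_distrib]

lemma firstCell_sum {ι : Type*} (t : Finset ι) (g : ι → ℕ → PowerSeries ℂ) :
    firstCell (fun k => ∑ i ∈ t, g i k) = ∑ i ∈ t, firstCell (g i) := by
  ext n
  simp only [coeff_firstCell, map_sum, mul_sum]
  exact sum_comm

lemma sum_antidiagonal_assoc (n : ℕ) (F : ℕ → ℕ → ℕ → ℂ) :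
    ∑ p ∈ antidiagonal n, ∑ q ∈ antidiagonal p.1, F q.1 q.2 p.2 =
      ∑ p ∈ antidiagonal n, ∑ q ∈ antidiagonal p.2, F p.1 q.1 q.2 := by
  rw [sum_sigma', sum_sigma']
  refine sum_nbij' (fun x => ⟨(x.2.1, x.2.2 + x.1.2), (x.2.2, x.1.2)⟩)
    (fun x => ⟨(x.1.1 + x.2.1, x.2.2), (x.1.1, x.2.1)⟩) ?_ ?_ ?_ ?_ ?_
  · rintro ⟨⟨a, c⟩, ⟨d, e⟩⟩
    simp only [mem_sigma, HasAntidiagonal.mem_antidiagonal]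
    rintro ⟨h1, h2⟩
    subst h2 h1
    exact ⟨by omega, trivial⟩
  · rintro ⟨⟨a, c⟩, ⟨d, e⟩⟩
    simp only [mem_sigma, HasAntidiagonal.mem_antidiagonal]
    rintro ⟨h1, h2⟩
    subst h2 h1
    exact ⟨by omega, trivial⟩
  · rintro ⟨⟨a, c⟩, ⟨d, e⟩⟩
    simp only [mem_sigma, HasAntidiagonal.mem_antidiagonal]
    rintro ⟨-, rfl⟩
    rfl
  · rintro ⟨⟨a, c⟩, ⟨d, e⟩⟩
    simp only [mem_sigma, HasAntidiagonal.mem_antidiagonal]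
    rintro ⟨-, rfl⟩
    rfl
  · rintro ⟨⟨a, c⟩, ⟨d, e⟩⟩ _
    rfl

lemma firstCell_mul (g : ℕ → PowerSeries ℂ) (f : PowerSeries ℂ) :
    firstCell g * f = firstCell fun k => g k * f := by
  ext n
  simp only [PowerSeries.coeff_mul, coeff_firstCell, mul_sum, sum_mul]
  rw [sum_antidiagonal_assoc n fun a c d => ((a.factorial : ℂ))⁻¹ *
    PowerSeries.coeff c (g a) * PowerSeries.coeff d f]
  simp only [mul_assoc]

lemma weightSum_zero (m n : ℕ) : weightSum m n (fun _ => 0) = 0 := by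
  induction m generalizing n with
  | zero => simp [weightSum]
  | succ m ih => simp [weightSum, ih]

lemma openGF_eq_zero {b m k s : ℕ} (h : m ≤ k) : openGF b m k s = 0 := by
  classical
  ext n
  rw [openGF, PowerSeries.coeff_mk, map_zero]
  refine (weightSum_congr fun x => if_neg fun hx => ?_).trans (weightSum_zero m n)
  exact absurd hx.1 (by omega)

lemma endsOpen_one (b s : ℕ) (x : ℕ → ℕ) : EndsOpen b 1 0 s x ↔ x 0 + s < b := by
  simp [EndsOpen, load_zero]

lemma endsOpen_succ {b m k : ℕ} (hk : k < m) (s a : ℕ) (x : ℕ → ℕ) :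
    EndsOpen b (m + 1) k s (natCons a x) ↔ EndsOpen b m k (a + s - b) x := by
  obtain ⟨m, rfl⟩ : ∃ n, m = n + 1 := ⟨m - 1, by omega⟩
  unfold EndsOpen
  simp only [add_tsub_cancel_right, load_shift]
  change _ ∧ load b (a + s - b) x m < b ∧ _ ↔ _
  refine and_congr (by omega) (and_congr_right fun _ => ⟨fun H j h1 h2 => ?_, fun H j h1 h2 => ?_⟩)
  · have := H (j + 1) (by omega) (by omega)
    rwa [load_shift] at this
  · obtain ⟨j, rfl⟩ : ∃ i, j = i + 1 := ⟨j - 1, by omega⟩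
    rw [load_shift]
    exact H j (by omega) (by omega)

lemma endsOpen_succ_self (b m s a : ℕ) (x : ℕ → ℕ) :
    EndsOpen b (m + 2) (m + 1) s (natCons a x) ↔
      b ≤ a + s ∧ EndsOpen b (m + 1) m (a + s - b) x := by
  unfold EndsOpen
  simp only [add_tsub_cancel_right, show m + 2 - 1 = m + 1 from rfl, load_shift]
  change _ ∧ load b (a + s - b) x m < b ∧ _ ↔ b ≤ a + s ∧ _ ∧ load b (a + s - b) x m < b ∧ _
  constructor
  · rintro ⟨h1, h2, h3⟩
    refine ⟨h3 0 (by omega) (by omega), by omega, h2, fun j hj _ => ?_⟩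
    have := h3 (j + 1) (by omega) (by omega)
    rwa [load_shift] at this
  · rintro ⟨h1, h2, h3, h4⟩
    refine ⟨by omega, h3, fun j hj _ => ?_⟩
    rcases j with _ | j
    · exact h1
    · rw [load_shift]
      exact h4 j (by omega) (by omega)

/-- The window of `k` full cells does not reach the first cell, which therefore matters only through
its overflow. -/
lemma openGF_succ {b m k : ℕ} (hk : k < m) (s : ℕ) :
    openGF b (m + 1) k s = firstCell fun a => openGF b m k (a + s - b) := by
  classical
  ext n
  simp only [coeff_firstCell, openGF, PowerSeries.coeff_mk, weightSum]
  refine sum_congr rfl fun p _ => congrArg _ (weightSum_congr fun x => ?_)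
  simp only [endsOpen_succ hk]

/-- Here the window contains the first cell, which must itself be full. -/
lemma openGF_succ_self (b m s : ℕ) :
    openGF b (m + 2) (m + 1) s =
      firstCell fun a => if b ≤ a + s then openGF b (m + 1) m (a + s - b) else 0 := by
  classical
  ext n
  rw [coeff_firstCell, openGF, PowerSeries.coeff_mk, weightSum]
  refine sum_congr rfl fun p _ => congrArg _ ?_
  split_ifs with h
  · rw [openGF, PowerSeries.coeff_mk]
    exact weightSum_congr fun x => by simp only [endsOpen_succ_self, h, true_and]
  · rw [map_zero]
    exact (weightSum_congr fun x => if_neg fun hx =>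
      h ((endsOpen_succ_self _ _ _ _ _).1 hx).1).trans (weightSum_zero _ _)

lemma openGF_one (b s : ℕ) :
    openGF b 1 0 s = firstCell fun a => if a + s < b then 1 else 0 := by
  classical
  ext n
  rw [coeff_firstCell, openGF, PowerSeries.coeff_mk, weightSum]
  refine sum_congr rfl fun p _ => congrArg _ ?_
  simp only [weightSum, endsOpen_one]
  change (if p.2 = 0 then (if p.1 + s < b then (1 : ℂ) else 0) else 0) = _
  split_ifs <;> simp [PowerSeries.coeff_one, *]

/-- Generating function of the lines of `m` cells in which only the last cell is open. -/
noncomputable def firstOpenGF (b m s : ℕ) : PowerSeries ℂ :=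
  if m = 0 then 0 else openGF b m (m - 1) s

lemma firstOpenGF_zero (b s : ℕ) : firstOpenGF b 0 s = 0 := rfl

lemma firstOpenGF_one (b s : ℕ) :
    firstOpenGF b 1 s = firstCell fun a => if a + s < b then 1 else 0 := openGF_one b s

lemma firstOpenGF_succ (b m s : ℕ) (hm : m ≠ 0) :
    firstOpenGF b (m + 1) s =
      firstCell fun a => if b ≤ a + s then firstOpenGF b m (a + s - b) else 0 := by
  obtain ⟨m, rfl⟩ := Nat.exists_eq_succ_of_ne_zero hm
  exact openGF_succ_self b m s

/-- A line with an open last cell splits at the first open cell. -/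
lemma openGF_eq_sum (b m k s : ℕ) :
    openGF b m k s = (if k < m then firstOpenGF b m s else 0) +
      ∑ j ∈ range m, firstOpenGF b j s * openGF b (m - j) k 0 := by
  induction m generalizing s with
  | zero => simp [openGF_eq_zero]
  | succ m ih =>
    rcases lt_trichotomy k m with hk | rfl | hk
    · rw [openGF_succ hk, if_pos (by omega), firstOpenGF_succ b m s (by omega), sum_range_succ',
        firstOpenGF_zero, zero_mul, add_zero]
      obtain ⟨m, rfl⟩ : ∃ n, m = n + 1 := ⟨m - 1, by omega⟩
      rw [sum_range_succ']
      have h1 : ∀ j ∈ range m, firstOpenGF b (j + 1 + 1) s * openGF b (m + 1 + 1 - (j + 1 + 1)) k 0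
          = firstCell fun a => (if b ≤ a + s then firstOpenGF b (j + 1) (a + s - b) else 0) *
              openGF b (m - j) k 0 := by
        intro j _
        rw [firstOpenGF_succ _ _ _ (by omega), firstCell_mul,
          show m + 1 + 1 - (j + 1 + 1) = m - j by omega]
      rw [sum_congr rfl h1, ← firstCell_sum, zero_add, firstOpenGF_one, firstCell_mul,
        ← firstCell_add, ← firstCell_add]
      congr 1
      funext a
      -- If the first cell is open, the cut is right after it and the rest starts with overflow
      -- zero. Otherwise the induction hypothesis cuts the remaining line.
      rcases lt_or_ge (a + s) b with h | h
      · simp [not_le.2 h, h, Nat.sub_eq_zero_of_le h.le]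
      · simp only [h, if_true, not_lt.2 h, if_false, zero_mul, add_zero]
        rw [ih, if_pos hk, sum_range_succ', firstOpenGF_zero, zero_mul, add_zero]
        congr 1
        refine sum_congr rfl fun j _ => ?_
        congr 2; omega
    -- For `k = m` all earlier cells must be full, so there is no earlier cut.
    · rw [if_pos (by omega), sum_eq_zero, add_zero]
      · rfl
      · intro j hj
        rcases Nat.eq_zero_or_pos j with rfl | hj'
        · rw [firstOpenGF_zero, zero_mul]
        · rw [openGF_eq_zero (by omega), mul_zero]
    · rw [openGF_eq_zero (by omega), if_neg (by omega), sum_eq_zero, add_zero]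
      intro j _
      rw [openGF_eq_zero (by omega), mul_zero]

/-- The `m - 1` full cells hold `b` keys each and the last fewer than `b`, so the `n + s` keys
determine `m`. -/
lemma coeff_firstOpenGF_of_ne {b : ℕ} (hb : 0 < b) (m n s : ℕ) (h : m ≠ (n + s) / b + 1) :
    PowerSeries.coeff n (firstOpenGF b m s) = 0 := by
  rcases m with _ | m
  · simp [firstOpenGF_zero]
  induction m generalizing n s with
  | zero =>
    rw [zero_add, firstOpenGF_one, coeff_firstCell]
    refine sum_eq_zero fun p hp => ?_
    rw [HasAntidiagonal.mem_antidiagonal] at hp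
    split_ifs with h1
    · rw [PowerSeries.coeff_one, if_neg, mul_zero]
      intro h2
      apply h
      rw [Nat.div_eq_of_lt (by omega)]
    · simp
  | succ m ih =>
    rw [firstOpenGF_succ _ _ _ (by omega), coeff_firstCell]
    refine sum_eq_zero fun p hp => ?_
    rw [HasAntidiagonal.mem_antidiagonal] at hp
    split_ifs with h1
    · rw [ih, mul_zero]
      intro h2
      apply h
      rw [show n + s = p.2 + (p.1 + s - b) + b by omega, Nat.add_div_right _ hb]
      omega
    · simp

/-! ### The tree function -/

/-- The tree function as a formal power series. -/
noncomputable def treeSeries : PowerSeries ℂ :=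
  PowerSeries.mk fun n : ℕ => if n = 0 then (0 : ℂ) else (n : ℂ) ^ (n - 1) / (n.factorial : ℂ)

/-- `T(x) / x`. -/
noncomputable def treeQuot : PowerSeries ℂ :=
  PowerSeries.mk fun n : ℕ => ((n : ℂ) + 1) ^ n / ((n + 1).factorial : ℂ)

lemma treeSeries_eq : treeSeries = PowerSeries.X * treeQuot := by
  ext n
  rcases n with _ | n
  · simp [treeSeries]
  · rw [PowerSeries.coeff_succ_X_mul]
    simp [treeSeries, treeQuot]

lemma sum_alternating_choose_pow (n : ℕ) (hn : 2 ≤ n) :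
    ∑ d ∈ range (n + 1), (-1 : ℂ) ^ (n - d) * (n.choose d : ℂ) * (d : ℂ) ^ (n - 1) = 0 := by
  have h := congrFun (fwdDiff_iter_pow_eq_zero_of_lt (R := ℂ) (j := n - 1) (n := n) (by omega)) 0
  rw [fwdDiff_iter_eq_sum_shift] at h
  simpa using h

/-- The compositional inverse `x * exp (-x)` of the tree function. -/
noncomputable def treeInv : PowerSeries ℂ :=
  PowerSeries.X * PowerSeries.rescale (-1) (PowerSeries.exp ℂ)

lemma coeff_treeInv_pow (d n : ℕ) :
    PowerSeries.coeff n (treeInv ^ d) =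
      if d ≤ n then (-(d : ℂ)) ^ (n - d) / ((n - d).factorial : ℂ) else 0 := by
  rw [treeInv, mul_pow, PowerSeries.coeff_X_pow_mul', ← map_pow, PowerSeries.exp_pow_eq_rescale_exp]
  split_ifs with h
  · simp only [PowerSeries.coeff_rescale, PowerSeries.coeff_exp]
    rw [← mul_assoc, ← mul_pow]
    simp [div_eq_mul_inv]
  · rfl

lemma constantCoeff_treeInv : PowerSeries.constantCoeff treeInv = 0 := by
  simp [treeInv]

lemma hasSubst_treeInv : PowerSeries.HasSubst treeInv :=
  PowerSeries.HasSubst.of_constantCoeff_zero' constantCoeff_treeInv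

/-- For `n ≥ 2`, `n!` times the coefficient is an `n`-th finite difference of a power of degree `n -
1`, hence zero. -/
lemma treeSeries_subst_treeInv : treeSeries.subst treeInv = PowerSeries.X := by
  ext n
  rw [PowerSeries.coeff_subst' hasSubst_treeInv, finsum_eq_sum_of_support_subset (s := range (n + 1))]
  · simp only [coeff_treeInv_pow, smul_eq_mul, treeSeries, PowerSeries.coeff_mk]
    rcases n with _ | _ | n
    · simp
    · simp [sum_range_succ]
    · rw [PowerSeries.coeff_X, if_neg (by omega)]
      simp only [add_assoc, Nat.reduceAdd]
      have h := sum_alternating_choose_pow (n + 2) (by omega)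
      have h2 : ((n + 2).factorial : ℂ) ≠ 0 := by exact_mod_cast (n + 2).factorial_ne_zero
      rw [← mul_right_inj' h2, mul_zero, mul_sum, ← h]
      refine sum_congr rfl fun d hd => ?_
      have hd' : d ≤ n + 2 := by simpa [Nat.lt_succ_iff] using hd
      rcases Nat.eq_zero_or_pos d with rfl | hd0
      · simp
      · rw [if_pos hd', if_neg hd0.ne', ← Nat.choose_mul_factorial_mul_factorial hd']
        have h3 : (d.factorial : ℂ) ≠ 0 := by exact_mod_cast d.factorial_ne_zero
        have h4 : ((n + 2 - d).factorial : ℂ) ≠ 0 := by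
          exact_mod_cast (n + 2 - d).factorial_ne_zero
        push_cast
        rw [neg_pow (d : ℂ), show n + 1 = (d - 1) + (n + 2 - d) by omega, pow_add (d : ℂ)]
        field_simp
  · intro d hd
    by_contra h
    apply hd
    simp only [coe_range, Set.mem_Iio, not_lt] at h
    dsimp only
    rw [coeff_treeInv_pow, if_neg (by omega), smul_zero]

lemma isUnit_coeff_one_treeInv : IsUnit (PowerSeries.coeff 1 treeInv) := by
  have := coeff_treeInv_pow 1 1
  rw [pow_one] at this
  rw [this]; simp

/-- A left inverse of `treeInv` under composition coincides with its right inverse, which makes the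
identity usable in the other order. -/
lemma treeSeries_eq_substInv :
    treeSeries = treeInv.substInvOfIsUnit isUnit_coeff_one_treeInv := by
  set g := treeInv.substInvOfIsUnit isUnit_coeff_one_treeInv with hg
  have hgs : PowerSeries.HasSubst g := PowerSeries.HasSubst.substInvOfIsUnit _ _
  have h := congrArg (PowerSeries.subst g) treeSeries_subst_treeInv
  rw [PowerSeries.subst_comp_subst_apply hasSubst_treeInv hgs, PowerSeries.subst_X hgs,
    PowerSeries.subst_substInvOfIsUnit_right _ constantCoeff_treeInv, PowerSeries.X_subst] at h
  exact h

lemma constantCoeff_treeSeries : PowerSeries.constantCoeff treeSeries = 0 := by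
  simp [treeSeries_eq]

lemma hasSubst_treeSeries : PowerSeries.HasSubst treeSeries :=
  PowerSeries.HasSubst.of_constantCoeff_zero' constantCoeff_treeSeries

/-- The functional equation `T(x) = x * exp (T(x))`. -/
lemma treeQuot_eq : treeQuot = (PowerSeries.exp ℂ).subst treeSeries := by
  have h1 : treeInv.subst treeSeries = PowerSeries.X := by
    rw [treeSeries_eq_substInv,
      PowerSeries.subst_substInvOfIsUnit_right _ constantCoeff_treeInv]
  rw [treeInv, PowerSeries.subst_mul hasSubst_treeSeries, PowerSeries.subst_X hasSubst_treeSeries]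
    at h1
  have h2 : (PowerSeries.rescale (-1 : ℂ) (PowerSeries.exp ℂ)).subst treeSeries *
      (PowerSeries.exp ℂ).subst treeSeries = 1 := by
    rw [← PowerSeries.subst_mul hasSubst_treeSeries, mul_comm]
    have := PowerSeries.exp_mul_exp_neg_eq_one (A := ℂ)
    rw [PowerSeries.evalNegHom] at this
    rw [this, ← PowerSeries.coe_substAlgHom hasSubst_treeSeries, map_one]
  have h3 : treeSeries = PowerSeries.X * (PowerSeries.exp ℂ).subst treeSeries := by
    rw [← h1, mul_assoc, h2, mul_one]
  rw [treeSeries_eq] at h3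
  have h4 := mul_left_cancel₀ PowerSeries.X_ne_zero h3
  rw [← treeSeries_eq] at h4
  exact h4

/-- This is `(T / x) ^ b = exp (b T)`, expanded in powers of `T = x * (T / x)`; `firstCell` supplies
the factor `x ^ k / k!`. -/
lemma treeQuot_pow (b : ℕ) :
    treeQuot ^ b = firstCell fun k => PowerSeries.C ((b : ℂ) ^ k) * treeQuot ^ k := by
  ext n
  nth_rw 1 [treeQuot_eq]
  rw [← PowerSeries.subst_pow hasSubst_treeSeries, PowerSeries.exp_pow_eq_rescale_exp,
    PowerSeries.coeff_subst' hasSubst_treeSeries,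
    finsum_eq_sum_of_support_subset (s := range (n + 1)), coeff_firstCell,
    Nat.sum_antidiagonal_eq_sum_range_succ_mk]
  · refine sum_congr rfl fun d hd => ?_
    rw [treeSeries_eq, mul_pow, PowerSeries.coeff_X_pow_mul', if_pos (by simpa [Nat.lt_succ_iff] using hd)]
    simp only [PowerSeries.coeff_rescale, PowerSeries.coeff_exp, PowerSeries.coeff_C_mul, smul_eq_mul]
    simp
    ring
  · intro d hd
    by_contra h
    apply hd
    simp only [coe_range, Set.mem_Iio, not_lt] at h
    dsimp only
    rw [treeSeries_eq, mul_pow, PowerSeries.coeff_X_pow_mul', if_neg (by omega), smul_zero]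

/-- The power series `ζ * T(ζ x) / (ζ x)`. -/
noncomputable def twistedTree (ζ : ℂ) : PowerSeries ℂ :=
  PowerSeries.C ζ * PowerSeries.rescale ζ treeQuot

/-- Rescaling by a `b`-th root of unity preserves the equation, because the factor `ζ ^ b`
disappears. -/
lemma twistedTree_pow {b : ℕ} {ζ : ℂ} (hζ : ζ ^ b = 1) :
    twistedTree ζ ^ b =
      firstCell fun k => PowerSeries.C ((b : ℂ) ^ k) * twistedTree ζ ^ k := by
  ext n
  simp only [twistedTree, mul_pow, ← map_pow, hζ]
  rw [map_one, one_mul, treeQuot_pow, PowerSeries.coeff_rescale, coeff_firstCell, coeff_firstCell,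
    mul_sum]
  refine sum_congr rfl fun p hp => ?_
  simp only [PowerSeries.coeff_C_mul, PowerSeries.coeff_rescale]
  rw [← HasAntidiagonal.mem_antidiagonal.1 hp, pow_add]
  ring

/-! ### Roots of the cluster polynomial -/

lemma coeff_firstOpenGF_rec {b : ℕ} (hb : 0 < b) (n s : ℕ) :
    PowerSeries.coeff n (firstOpenGF b ((n + s) / b + 1) s) = ∑ p ∈ antidiagonal n,
      ((p.1.factorial : ℂ))⁻¹ * if p.1 + s < b then (if p.2 = 0 then 1 else 0) else
        PowerSeries.coeff p.2 (firstOpenGF b ((p.2 + (p.1 + s - b)) / b + 1) (p.1 + s - b)) := by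
  rcases lt_or_ge (n + s) b with h | h
  · rw [Nat.div_eq_of_lt h, zero_add, firstOpenGF_one, coeff_firstCell]
    refine sum_congr rfl fun p hp => ?_
    rw [HasAntidiagonal.mem_antidiagonal] at hp
    rw [if_pos (by omega), if_pos (by omega), PowerSeries.coeff_one]
  · have h1 : (n + s) / b = (n + s - b) / b + 1 := by
      rw [← Nat.add_div_right _ hb, Nat.sub_add_cancel h]
    rw [firstOpenGF_succ b ((n + s) / b) s (by rw [h1]; exact Nat.succ_ne_zero _), coeff_firstCell]
    refine sum_congr rfl fun p hp => ?_
    rw [HasAntidiagonal.mem_antidiagonal] at hp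
    rcases lt_or_ge (p.1 + s) b with h2 | h2
    · rw [if_neg (by omega), if_pos h2, if_neg (by omega), map_zero]
    · rw [if_pos h2, if_neg (by omega), h1, show p.2 + (p.1 + s - b) = n + s - b by omega]

/-- Replacing `v ^ b` by its expansion adds a cell with `k` keys to overflow `s`. If `s + k < b` the
line stops at `v ^ (s + k)`; otherwise overflow `s + k - b` remains and the step repeats. Both sides
thus satisfy the cluster recursion. -/
lemma coeff_pow_add_eq {b : ℕ} (hb : 0 < b) {v : PowerSeries ℂ}
    (hv : v ^ b = firstCell fun k => PowerSeries.C ((b : ℂ) ^ k) * v ^ k) (n s : ℕ) :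
    PowerSeries.coeff n (v ^ (s + b)) = ∑ p ∈ antidiagonal n, (b : ℂ) ^ p.1 *
      PowerSeries.coeff p.1 (firstOpenGF b ((p.1 + s) / b + 1) s) *
        PowerSeries.coeff p.2 (v ^ ((p.1 + s) % b)) := by
  induction n using Nat.strong_induction_on generalizing s with
  | _ n ihn =>
  induction s using Nat.strong_induction_on with
  | _ s ihs =>
  rw [pow_add, mul_comm, hv, firstCell_mul, coeff_firstCell]
  have h1 : ∀ p ∈ antidiagonal n, (b : ℂ) ^ p.1 *
      PowerSeries.coeff p.1 (firstOpenGF b ((p.1 + s) / b + 1) s) *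
        PowerSeries.coeff p.2 (v ^ ((p.1 + s) % b)) = ∑ q ∈ antidiagonal p.1,
      (b : ℂ) ^ (q.1 + q.2) * (((q.1.factorial : ℂ))⁻¹ * if q.1 + s < b then
        (if q.2 = 0 then 1 else 0) else
        PowerSeries.coeff q.2 (firstOpenGF b ((q.2 + (q.1 + s - b)) / b + 1) (q.1 + s - b))) *
        PowerSeries.coeff p.2 (v ^ ((q.1 + q.2 + s) % b)) := by
    intro p _
    rw [coeff_firstOpenGF_rec hb, mul_sum, sum_mul]
    refine sum_congr rfl fun q hq => ?_
    rw [HasAntidiagonal.mem_antidiagonal.1 hq]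
  rw [sum_congr rfl h1, sum_antidiagonal_assoc n fun i j k =>
    (b : ℂ) ^ (i + j) * (((i.factorial : ℂ))⁻¹ * if i + s < b then
        (if j = 0 then 1 else 0) else
        PowerSeries.coeff j (firstOpenGF b ((j + (i + s - b)) / b + 1) (i + s - b))) *
        PowerSeries.coeff k (v ^ ((i + j + s) % b))]
  refine sum_congr rfl fun p hp => ?_
  rw [HasAntidiagonal.mem_antidiagonal] at hp
  rw [mul_assoc, ← pow_add, PowerSeries.coeff_C_mul]
  rcases lt_or_ge (p.1 + s) b with h | h
  · rw [sum_eq_single (0, p.2)]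
    · simp only [h, if_true, add_zero, Nat.mod_eq_of_lt h]
      ring
    · rintro ⟨i, j⟩ hq hne
      rw [HasAntidiagonal.mem_antidiagonal] at hq
      have : i ≠ 0 := by
        rintro rfl
        apply hne
        simp_all
      simp [h, this]
    · intro hn
      exact absurd (HasAntidiagonal.mem_antidiagonal.2 (by simp)) hn
  · have h2 : PowerSeries.coeff p.2 (v ^ (p.1 + s - b + b)) = ∑ q ∈ antidiagonal p.2,
        (b : ℂ) ^ q.1 * PowerSeries.coeff q.1
          (firstOpenGF b ((q.1 + (p.1 + s - b)) / b + 1) (p.1 + s - b)) *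
          PowerSeries.coeff q.2 (v ^ ((q.1 + (p.1 + s - b)) % b)) := by
      -- An empty cell leaves `n` unchanged but lowers `s` by `b`, hence the inner induction on `s`.
      rcases Nat.eq_zero_or_pos p.1 with h0 | h0
      · rw [show p.2 = n by omega]
        exact ihs (p.1 + s - b) (by omega)
      · exact ihn p.2 (by omega) (p.1 + s - b)
    rw [Nat.sub_add_cancel h] at h2
    rw [h2, mul_sum, mul_sum]
    refine sum_congr rfl fun q _ => ?_
    rw [if_neg (by omega), pow_add, show p.1 + q.1 + s = q.1 + (p.1 + s - b) + b by omega,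
      Nat.add_mod_right]
    ring

/-- `F_d(b u)` as a power series in `u`. -/
noncomputable def scaledAlmostFull (b d : ℕ) : PowerSeries ℂ :=
  PowerSeries.rescale (b : ℂ) (PowerSeries.mk fun n : ℕ =>
    if n % b = d then (almostFullCount b n : ℂ) / (n.factorial : ℂ) else 0)

lemma almostFullCount_div (b n : ℕ) :
    (almostFullCount b n : ℂ) / (n.factorial : ℂ) =
      PowerSeries.coeff n (firstOpenGF b (n / b + 1) 0) := by
  have h : (n.factorial : ℂ) ≠ 0 := by exact_mod_cast n.factorial_ne_zero
  rw [almostFullCount_eq, mul_div_cancel_left₀ _ h]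
  rfl

lemma pow_eq_sum_scaledAlmostFull {b : ℕ} (hb : 0 < b) {v : PowerSeries ℂ}
    (hv : v ^ b = firstCell fun k => PowerSeries.C ((b : ℂ) ^ k) * v ^ k) :
    v ^ b = ∑ d ∈ range b, scaledAlmostFull b d * v ^ d := by
  ext n
  have h := coeff_pow_add_eq hb hv n 0
  rw [zero_add] at h
  simp only [map_sum, PowerSeries.coeff_mul]
  rw [h, sum_comm]
  refine sum_congr rfl fun p _ => ?_
  rw [sum_eq_single (p.1 % b)]
  · simp only [scaledAlmostFull, PowerSeries.coeff_rescale, PowerSeries.coeff_mk, if_true,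
      almostFullCount_div, add_zero]
  · intro d _ hd
    simp [scaledAlmostFull, PowerSeries.coeff_rescale, hd.symm]
  · intro hn
    exact absurd (mem_range.2 (Nat.mod_lt _ hb)) hn

lemma isPrimitiveRoot_omegaRoot {b : ℕ} (hb : 0 < b) : IsPrimitiveRoot (omegaRoot b) b :=
  Complex.isPrimitiveRoot_exp b hb.ne'

lemma constantCoeff_twistedTree (ζ : ℂ) : PowerSeries.constantCoeff (twistedTree ζ) = ζ := by
  rw [twistedTree, map_mul, ← PowerSeries.coeff_zero_eq_constantCoeff_apply,
    ← PowerSeries.coeff_zero_eq_constantCoeff_apply, PowerSeries.coeff_rescale]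
  simp [treeQuot]

open Polynomial in
/-- The cluster polynomial splits, its roots being `ω ^ j * exp (T(ω ^ j u))`. -/
lemma cluster_polynomial_eq_prod {b : ℕ} (hb : 0 < b) :
    (Polynomial.X ^ b - ∑ d ∈ range b, Polynomial.C (scaledAlmostFull b d) * Polynomial.X ^ d :
      (PowerSeries ℂ)[X]) =
      ∏ j ∈ range b, (Polynomial.X - Polynomial.C (twistedTree (omegaRoot b ^ j))) := by
  have hω := isPrimitiveRoot_omegaRoot hb
  set W : (PowerSeries ℂ)[X] :=
    ∏ j ∈ range b, (Polynomial.X - Polynomial.C (twistedTree (omegaRoot b ^ j))) with hW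
  have hWm : W.Monic := monic_prod_X_sub_C _ _
  have hWd : W.natDegree = b := by
    rw [hW, natDegree_finsetProd_X_sub_C_eq_card, card_range]
  -- Both `∑ F_d X ^ d` and `X ^ b - W` have degree below `b`, so agreement at the `b` points
  -- suffices. These points are distinct because their constant terms are the distinct powers of
  -- `ω`.
  rw [sub_eq_iff_eq_add, ← sub_eq_iff_eq_add', eq_comm]
  refine Polynomial.eq_of_degrees_lt_of_eval_index_eq (range b)
    (v := fun j => twistedTree (omegaRoot b ^ j)) ?_ ?_ ?_ ?_
  · intro i hi j hj hij
    have := congrArg PowerSeries.constantCoeff hij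
    simp only [constantCoeff_twistedTree] at this
    exact hω.pow_inj (by simpa using hi) (by simpa using hj) this
  · rw [card_range]
    refine (Polynomial.degree_sum_le _ _).trans_lt ?_
    rw [Finset.sup_lt_iff (by exact WithBot.bot_lt_coe b)]
    intro d hd
    exact (degree_C_mul_X_pow_le d _).trans_lt (by exact_mod_cast mem_range.1 hd)
  · rw [card_range]
    have h1 : (Polynomial.X ^ b : (PowerSeries ℂ)[X]).degree = b := degree_X_pow b
    have h2 : W.degree = b := by rw [degree_eq_natDegree hWm.ne_zero, hWd]
    have h3 := degree_sub_lt_left (h1.trans h2.symm) (pow_ne_zero b X_ne_zero)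
      (by rw [hWm.leadingCoeff, (monic_X_pow b).leadingCoeff])
    rwa [h1] at h3
  · intro j hj
    have hz : W.eval (twistedTree (omegaRoot b ^ j)) = 0 := by
      rw [hW, eval_prod]
      exact prod_eq_zero hj (by simp)
    rw [eval_sub, hz, sub_zero, eval_pow, eval_X, eval_finsetSum]
    simp only [eval_mul, eval_C, eval_pow, eval_X]
    refine (pow_eq_sum_scaledAlmostFull hb (twistedTree_pow ?_)).symm
    rw [← pow_mul, mul_comm, pow_mul, hω.pow_eq_one, one_pow]

/-! ### Substituting monomials -/

lemma prod_monomial_pow {σ τ : Type*} (φ : σ → τ →₀ ℕ) (c : σ → ℂ) (d : σ →₀ ℕ) :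
    (d.prod fun s k => MvPowerSeries.monomial (φ s) (c s) ^ k) =
      MvPowerSeries.monomial (d.sum fun s k => k • φ s) (d.prod fun s k => c s ^ k) := by
  classical
  simp_rw [MvPowerSeries.monomial_pow]
  rw [Finsupp.prod, Finsupp.sum, Finsupp.prod]
  induction d.support using Finset.induction_on with
  | empty => simp
  | insert a s ha ih => rw [prod_insert ha, sum_insert ha, prod_insert ha, ih,
      MvPowerSeries.monomial_mul_monomial]

lemma coeff_subst_monomial {σ τ : Type*} {φ : σ → τ →₀ ℕ} {c : σ → ℂ}
    (ha : MvPowerSeries.HasSubst fun s => MvPowerSeries.monomial (φ s) (c s))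
    (f : MvPowerSeries σ ℂ) {d : σ →₀ ℕ} {e : τ →₀ ℕ}
    (hd : ∀ d' : σ →₀ ℕ, (d'.sum fun s k => k • φ s) = e ↔ d' = d) :
    MvPowerSeries.coeff e (MvPowerSeries.subst (fun s => MvPowerSeries.monomial (φ s) (c s)) f) =
      MvPowerSeries.coeff d f * d.prod fun s k => c s ^ k := by
  classical
  rw [MvPowerSeries.coeff_subst ha, finsum_eq_single _ d]
  · rw [prod_monomial_pow, MvPowerSeries.coeff_monomial, if_pos ((hd d).2 rfl).symm, smul_eq_mul]
  · intro d' hd'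
    rw [prod_monomial_pow, MvPowerSeries.coeff_monomial, if_neg, smul_zero]
    exact fun h => hd' ((hd d').1 h.symm)

lemma coeff_subst_monomial_of_ne {σ τ : Type*} {φ : σ → τ →₀ ℕ} {c : σ → ℂ}
    (ha : MvPowerSeries.HasSubst fun s => MvPowerSeries.monomial (φ s) (c s))
    (f : MvPowerSeries σ ℂ) {e : τ →₀ ℕ}
    (hd : ∀ d : σ →₀ ℕ, (d.sum fun s k => k • φ s) ≠ e) :
    MvPowerSeries.coeff e
      (MvPowerSeries.subst (fun s => MvPowerSeries.monomial (φ s) (c s)) f) = 0 := by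
  classical
  rw [MvPowerSeries.coeff_subst ha]
  refine finsum_eq_zero_of_forall_eq_zero fun d => ?_
  rw [prod_monomial_pow, MvPowerSeries.coeff_monomial, if_neg (hd d).symm, smul_zero]

lemma finsupp_fin_three_ext {d e : Fin 3 →₀ ℕ} :
    d = e ↔ d 0 = e 0 ∧ d 1 = e 1 ∧ d 2 = e 2 := by
  rw [DFunLike.ext_iff, Fin.forall_fin_succ, Fin.forall_fin_succ, Fin.forall_fin_succ]
  simp

/-- The substitution of `c * z`, `w ^ p`, `t ^ q` for the three variables. -/
noncomputable def powVars (c : ℂ) (p q : ℕ) : Fin 3 → GFRing :=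
  fun s => MvPowerSeries.monomial
    ((![Finsupp.single 0 1, Finsupp.single 1 p, Finsupp.single 2 q] : Fin 3 → Fin 3 →₀ ℕ) s)
    ((![c, 1, 1] : Fin 3 → ℂ) s)

lemma powVars_eq (c : ℂ) (p q : ℕ) :
    powVars c p q = ![c • zVar, wVar ^ p, tVar ^ q] := by
  funext s
  fin_cases s
  · simp [powVars, zVar, MvPowerSeries.X, ← map_smul]
  · simp [powVars, wVar, MvPowerSeries.X_pow_eq]
  · simp [powVars, tVar, MvPowerSeries.X_pow_eq]

lemma hasSubst_powVars (c : ℂ) {p q : ℕ} (hp : 0 < p) (hq : 0 < q) :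
    MvPowerSeries.HasSubst (powVars c p q) := by
  rw [powVars_eq]
  refine MvPowerSeries.hasSubst_of_constantCoeff_zero fun s => ?_
  fin_cases s <;> simp [zVar, wVar, tVar, hp.ne', hq.ne', MvPowerSeries.constantCoeff_smul]

lemma sum_powVars (p q : ℕ) (d e : Fin 3 →₀ ℕ) :
    (d.sum fun s k => k •
      (![Finsupp.single 0 1, Finsupp.single 1 p, Finsupp.single 2 q] : Fin 3 → Fin 3 →₀ ℕ) s) = e ↔
      d 0 = e 0 ∧ d 1 * p = e 1 ∧ d 2 * q = e 2 := by
  rw [Finsupp.sum_fintype _ _ (by simp), finsupp_fin_three_ext]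
  simp [Fin.sum_univ_three]

/-- The exponent vector `(i, j, k)`. -/
noncomputable def expVec (i j k : ℕ) : Fin 3 →₀ ℕ := Finsupp.equivFunOnFinite.symm ![i, j, k]

lemma coeff_subst_powVars (c : ℂ) {p q : ℕ} (hp : 0 < p) (hq : 0 < q)
    (f : MvPowerSeries (Fin 3) ℂ) (e : Fin 3 →₀ ℕ) :
    MvPowerSeries.coeff e (MvPowerSeries.subst (powVars c p q) f) =
      if p ∣ e 1 ∧ q ∣ e 2 then
        MvPowerSeries.coeff (expVec (e 0) (e 1 / p) (e 2 / q)) f * c ^ e 0 else 0 := by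
  split_ifs with h
  · refine (coeff_subst_monomial (hasSubst_powVars c hp hq) f
      (d := expVec (e 0) (e 1 / p) (e 2 / q)) ?_).trans ?_
    rotate_left
    · rw [Finsupp.prod_fintype _ _ (by simp)]
      simp [Fin.prod_univ_three, expVec]
    · intro d
      rw [sum_powVars, finsupp_fin_three_ext]
      obtain ⟨⟨u, hu⟩, ⟨v, hv⟩⟩ := h
      simp only [expVec, Finsupp.equivFunOnFinite_symm_apply_apply, Matrix.cons_val_zero, Matrix.cons_val_one,
        Matrix.cons_val, hu, hv, Nat.mul_div_cancel_left _ hp, Nat.mul_div_cancel_left _ hq]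
      rw [mul_comm p, mul_comm q, Nat.mul_left_inj hp.ne', Nat.mul_left_inj hq.ne']
  · refine coeff_subst_monomial_of_ne (hasSubst_powVars c hp hq) f fun d hd => h ?_
    rw [sum_powVars] at hd
    exact ⟨Dvd.intro_left _ hd.2.1, Dvd.intro_left _ hd.2.2⟩

/-- The series `∑ f m k * w ^ m * t ^ k`, where `f m k` is a series in `z`. -/
noncomputable def triGF (f : ℕ → ℕ → PowerSeries ℂ) : GFRing :=
  fun e => PowerSeries.coeff (e 0) (f (e 1) (e 2))

lemma coeff_triGF (f : ℕ → ℕ → PowerSeries ℂ) (e : Fin 3 →₀ ℕ) :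
    MvPowerSeries.coeff e (triGF f) = PowerSeries.coeff (e 0) (f (e 1) (e 2)) := rfl

lemma triGF_add (f g : ℕ → ℕ → PowerSeries ℂ) :
    triGF f + triGF g = triGF fun m k => f m k + g m k := by
  ext e
  simp [coeff_triGF]

lemma triGF_mul (f g : ℕ → ℕ → PowerSeries ℂ) :
    triGF f * triGF g = triGF fun m k => ∑ p ∈ antidiagonal m, ∑ q ∈ antidiagonal k,
      f p.1 q.1 * g p.2 q.2 := by
  ext e
  rw [MvPowerSeries.coeff_mul, coeff_triGF]
  simp only [map_sum, PowerSeries.coeff_mul]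
  simp_rw [← sum_product']
  refine sum_nbij'
    (fun d => ((d.1 1, d.2 1), ((d.1 2, d.2 2), (d.1 0, d.2 0))))
    (fun x => (expVec x.2.2.1 x.1.1 x.2.1.1, expVec x.2.2.2 x.1.2 x.2.1.2)) ?_ ?_ ?_ ?_ ?_
  · rintro ⟨d, d'⟩ h
    rw [HasAntidiagonal.mem_antidiagonal] at h
    simp [mem_product, HasAntidiagonal.mem_antidiagonal, ← h]
  · rintro ⟨⟨a, a'⟩, ⟨⟨c, c'⟩, ⟨d, d'⟩⟩⟩ h
    simp only [mem_product, HasAntidiagonal.mem_antidiagonal] at h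
    rw [HasAntidiagonal.mem_antidiagonal, finsupp_fin_three_ext]
    simp [expVec, h]
  · rintro ⟨d, d'⟩ h
    simp only [Prod.mk.injEq]
    constructor <;> rw [finsupp_fin_three_ext] <;> simp [expVec]
  · rintro ⟨⟨a, a'⟩, ⟨⟨c, c'⟩, ⟨d, d'⟩⟩⟩ h
    simp [expVec]
  · rintro ⟨d, d'⟩ h
    rfl

lemma coeff_subst_powVars_triGF (c : ℂ) {b : ℕ} (hb : 0 < b) (f : ℕ → ℕ → PowerSeries ℂ)
    (e : Fin 3 →₀ ℕ) :
    MvPowerSeries.coeff e (MvPowerSeries.subst (powVars c b b) (triGF f)) =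
      if b ∣ e 1 ∧ b ∣ e 2 then
        PowerSeries.coeff (e 0) (f (e 1 / b) (e 2 / b)) * c ^ e 0 else 0 := by
  rw [coeff_subst_powVars c hb hb]
  rfl

/-! ### The generating functions of the theorem -/

/-- The series into which `unsuccGF` substitutes. -/
noncomputable def unsuccSeries (b : ℕ) (a : (m : ℕ) → ZMod m) : MvPowerSeries (Fin 3) ℂ :=
  fun e => if b ∣ e 1 ∧ 1 ≤ e 1 / b then
    (unsuccProb b (e 1 / b) (e 0) (a (e 1 / b)) (e 2) : ℂ) *
      ((e 1 / b : ℕ) : ℂ) ^ (e 0) / ((e 0).factorial : ℂ) else 0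

/-- The series into which `tableGF` substitutes. -/
noncomputable def tableSeries (b : ℕ) : MvPowerSeries (Fin 2) ℂ :=
  fun e => if b ∣ e 1 then (lastNotFullCount b (e 1 / b) (e 0) : ℂ) / ((e 0).factorial : ℂ) else 0

lemma unsuccGF_eq {b : ℕ} (hb : 0 < b) (a : (m : ℕ) → ZMod m) :
    unsuccGF b a ((b : ℂ) • zVar) wVar (tVar ^ b) =
      MvPowerSeries.subst (powVars b b b) (triGF fun m k => openGF b m k 0) := by
  have h0 : unsuccGF b a ((b : ℂ) • zVar) wVar (tVar ^ b) =
      MvPowerSeries.subst (powVars b 1 b) (unsuccSeries b a) := by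
    rw [powVars_eq, pow_one]; rfl
  ext e
  rw [h0, coeff_subst_powVars_triGF _ hb, coeff_subst_powVars _ one_pos hb]
  simp only [one_dvd, true_and, Nat.div_one]
  by_cases h2 : b ∣ e 2
  · by_cases h1 : b ∣ e 1
    · simp only [h1, h2, and_self, if_true]
      congr 1
      change (if b ∣ e 1 ∧ 1 ≤ e 1 / b then
        (unsuccProb b (e 1 / b) (e 0) (a (e 1 / b)) (e 2 / b) : ℂ) *
          ((e 1 / b : ℕ) : ℂ) ^ (e 0) / ((e 0).factorial : ℂ) else 0) = _
      rcases Nat.eq_zero_or_pos (e 1 / b) with h | h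
      · rw [if_neg (by omega), h, openGF_eq_zero (Nat.zero_le _), map_zero]
      · have : NeZero (e 1 / b) := ⟨h.ne'⟩
        rw [if_pos ⟨h1, h⟩, unsuccProb_eq, mul_div_cancel_left₀]
        exact_mod_cast (e 0).factorial_ne_zero
    · simp only [h1, h2, if_true, false_and, if_false]
      change (if b ∣ e 1 ∧ 1 ≤ e 1 / b then
        (unsuccProb b (e 1 / b) (e 0) (a (e 1 / b)) (e 2 / b) : ℂ) *
          ((e 1 / b : ℕ) : ℂ) ^ (e 0) / ((e 0).factorial : ℂ) else 0) * _ = _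
      rw [if_neg (fun h => h1 h.1), zero_mul]
  · simp [h2]

lemma tableGF_eq {b : ℕ} (hb : 0 < b) :
    tableGF b ((b : ℂ) • zVar) wVar =
      MvPowerSeries.subst (powVars b b b) (triGF fun m k =>
        if k = 0 then (if m = 0 then 1 else openGF b m 0 0) else 0) := by
  have hv : (![(b : ℂ) • zVar, wVar] : Fin 2 → GFRing) = fun s => MvPowerSeries.monomial
      ((![Finsupp.single 0 1, Finsupp.single 1 1] : Fin 2 → Fin 3 →₀ ℕ) s)
      ((![(b : ℂ), 1] : Fin 2 → ℂ) s) := by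
    funext s
    fin_cases s
    · simp [zVar, MvPowerSeries.X, ← map_smul]
    · simp [wVar, MvPowerSeries.X]
  have hs : MvPowerSeries.HasSubst (![(b : ℂ) • zVar, wVar] : Fin 2 → GFRing) := by
    refine MvPowerSeries.hasSubst_of_constantCoeff_zero fun s => ?_
    fin_cases s <;> simp [zVar, wVar, MvPowerSeries.constantCoeff_smul]
  have hsum : ∀ (d : Fin 2 →₀ ℕ) (e : Fin 3 →₀ ℕ), (d.sum fun s k => k •
      (![Finsupp.single 0 1, Finsupp.single 1 1] : Fin 2 → Fin 3 →₀ ℕ) s) = e ↔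
      d 0 = e 0 ∧ d 1 = e 1 ∧ 0 = e 2 := by
    intro d e
    rw [Finsupp.sum_fintype _ _ (by simp), finsupp_fin_three_ext]
    simp [Fin.sum_univ_two]
  have h0 : tableGF b ((b : ℂ) • zVar) wVar =
      MvPowerSeries.subst ![(b : ℂ) • zVar, wVar] (tableSeries b) := rfl
  ext e
  rw [h0, coeff_subst_powVars_triGF _ hb]
  rw [hv] at hs ⊢
  by_cases h2 : e 2 = 0
  · rw [coeff_subst_monomial hs _ (d := Finsupp.equivFunOnFinite.symm ![e 0, e 1])]
    · rw [Finsupp.prod_fintype _ _ (by simp)]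
      simp only [Fin.prod_univ_two, h2, dvd_zero, and_true, Nat.zero_div, if_true]
      change (if b ∣ e 1 then (lastNotFullCount b (e 1 / b) (e 0) : ℂ) / ((e 0).factorial : ℂ)
        else 0) * (_ ^ e 0 * _ ^ e 1) = _
      by_cases h1 : b ∣ e 1
      · simp only [h1, if_true]
        simp only [Matrix.cons_val_zero, Matrix.cons_val_one, one_pow, mul_one]
        congr 1
        rcases Nat.eq_zero_or_pos (e 1 / b) with h | h
        · rw [h, if_pos rfl, PowerSeries.coeff_one, lastNotFullCount, if_pos rfl]
          split_ifs with h0 <;> simp [h0]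
        · rw [lastNotFullCount_eq b _ _ h, if_neg h.ne', mul_div_cancel_left₀]
          exact_mod_cast (e 0).factorial_ne_zero
      · simp [h1]
    · intro d
      rw [hsum, DFunLike.ext_iff (f := d)]
      simp [Fin.forall_fin_two, h2]
  · rw [coeff_subst_monomial_of_ne hs _ fun d hd => h2 ((hsum d e).1 hd).2.2.symm]
    by_cases h3 : b ∣ e 1 ∧ b ∣ e 2
    · rw [if_pos h3, if_neg fun h4 => h2 (Nat.eq_zero_of_dvd_of_div_eq_zero h3.2 h4), map_zero,
        zero_mul]
    · rw [if_neg h3]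

lemma coeff_almostFullGF {b d : ℕ} {ψ : Fin 3 →₀ ℕ} (hψ : ψ 0 = 0) (e : Fin 3 →₀ ℕ) :
    MvPowerSeries.coeff e
      (almostFullGF b d (((b : ℂ) • zVar) * MvPowerSeries.monomial ψ 1)) =
      if e = Finsupp.single 0 (e 0) + e 0 • ψ ∧ e 0 % b = d then
        (almostFullCount b (e 0) : ℂ) / ((e 0).factorial : ℂ) * (b : ℂ) ^ e 0 else 0 := by
  have hx : ((b : ℂ) • zVar) * MvPowerSeries.monomial ψ (1 : ℂ) =
      MvPowerSeries.monomial (Finsupp.single 0 1 + ψ) (b : ℂ) := by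
    rw [zVar, MvPowerSeries.X, ← map_smul, MvPowerSeries.monomial_mul_monomial]
    simp
  have hs : PowerSeries.HasSubst (MvPowerSeries.monomial (Finsupp.single 0 1 + ψ) (b : ℂ)) := by
    refine PowerSeries.HasSubst.monomial (fun h => ?_) _
    have := DFunLike.congr_fun h 0
    simp at this
  have hp : ∀ n : ℕ, (MvPowerSeries.monomial (Finsupp.single 0 1 + ψ) (b : ℂ)) ^ n =
      MvPowerSeries.monomial (Finsupp.single 0 n + n • ψ) ((b : ℂ) ^ n) := by
    intro n
    rw [MvPowerSeries.monomial_pow, smul_add]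
    simp
  rw [almostFullGF, hx, PowerSeries.coeff_subst hs, finsum_eq_single _ (e 0)]
  · rw [hp, MvPowerSeries.coeff_monomial, PowerSeries.coeff_mk]
    by_cases h1 : e = Finsupp.single 0 (e 0) + e 0 • ψ
    · rw [if_pos h1]
      by_cases h2 : e 0 % b = d
      · rw [if_pos h2, if_pos ⟨h1, h2⟩, smul_eq_mul]
      · rw [if_neg h2, if_neg (not_and_of_not_right _ h2), zero_smul]
    · rw [if_neg h1, if_neg (not_and_of_not_left _ h1), smul_zero]
  · intro n hn
    rw [hp, MvPowerSeries.coeff_monomial, if_neg, smul_zero]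
    intro h
    apply hn
    have := DFunLike.congr_fun h 0
    simpa [hψ] using this.symm

lemma coeff_clusterGF {b : ℕ} (hb : 0 < b) {ψ : Fin 3 →₀ ℕ} (hψ : ψ 0 = 0) (hψ1 : ψ 1 = 1)
    (e : Fin 3 →₀ ℕ) :
    MvPowerSeries.coeff e (clusterGF b ((b : ℂ) • zVar) (MvPowerSeries.monomial ψ 1)) =
      if e = Finsupp.single 0 (e 0) + e 1 • ψ ∧ b ∣ e 1 then
        PowerSeries.coeff (e 0) (firstOpenGF b (e 1 / b) 0) * (b : ℂ) ^ e 0 else 0 := by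
  have h1 : ∀ d ∈ range b, MvPowerSeries.coeff e (MvPowerSeries.monomial ψ (1 : ℂ) ^ (b - d) *
      almostFullGF b d (((b : ℂ) • zVar) * MvPowerSeries.monomial ψ 1)) =
      if d = e 0 % b then (if e = Finsupp.single 0 (e 0) + (e 0 + (b - d)) • ψ then
        (almostFullCount b (e 0) : ℂ) / ((e 0).factorial : ℂ) * (b : ℂ) ^ e 0 else 0) else 0 := by
    intro d _
    rw [MvPowerSeries.monomial_pow, MvPowerSeries.coeff_monomial_mul, one_pow, one_mul]
    by_cases hle : (b - d) • ψ ≤ e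
    · obtain ⟨e', rfl⟩ := le_iff_exists_add.1 hle
      rw [if_pos hle, add_tsub_cancel_left, coeff_almostFullGF hψ]
      have h0 : ((b - d) • ψ + e') 0 = e' 0 := by simp [hψ]
      have h1 : (b - d) • ψ + e' = Finsupp.single 0 (e' 0) + (e' 0 + (b - d)) • ψ ↔
          e' = Finsupp.single 0 (e' 0) + e' 0 • ψ := by
        rw [add_smul, ← add_assoc, add_comm ((b - d) • ψ) e', add_left_inj]
      simp only [h0, h1]
      by_cases hd : d = e' 0 % b
      · rw [if_pos hd]
        simp only [hd.symm, and_true]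
      · rw [if_neg hd, if_neg (not_and_of_not_right _ (Ne.symm hd))]
    · rw [if_neg hle, if_neg (c := e = _), ite_self]
      intro h
      apply hle
      rw [h, add_smul, ← add_assoc]
      exact le_add_self
  rw [clusterGF, map_sum, sum_congr rfl h1, sum_ite_eq' (range b) (e 0 % b),
    if_pos (mem_range.2 (Nat.mod_lt _ hb)), almostFullCount_div]
  -- The factor `y ^ (b - d)` counts the free places in the last bucket, bringing the exponent of
  -- `y` up to the capacity of the whole table.
  have h2 : e 0 + (b - e 0 % b) = b * (e 0 / b + 1) := by
    have := Nat.div_add_mod (e 0) b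
    have := Nat.mod_lt (e 0) hb
    rw [mul_add, mul_one]
    omega
  rw [h2]
  by_cases h3 : e = Finsupp.single 0 (e 0) + (b * (e 0 / b + 1)) • ψ
  · have h4 : e 1 = b * (e 0 / b + 1) := by
      conv_lhs => rw [h3]
      simp [hψ1]
    rw [if_pos h3, h4, if_pos ⟨h3, dvd_mul_right _ _⟩, Nat.mul_div_cancel_left _ hb]
  · rw [if_neg h3]
    split_ifs with h4
    · rw [coeff_firstOpenGF_of_ne hb, zero_mul]
      rintro h5
      apply h3
      rw [add_zero] at h5
      rw [← h5, Nat.mul_div_cancel' h4.2]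
      exact h4.1
    · rfl

lemma clusterGF_wVar_eq {b : ℕ} (hb : 0 < b) :
    clusterGF b ((b : ℂ) • zVar) wVar = MvPowerSeries.subst (powVars b b b)
      (triGF fun m k => if k = 0 then firstOpenGF b m 0 else 0) := by
  ext e
  rw [coeff_subst_powVars_triGF _ hb, wVar, MvPowerSeries.X,
    coeff_clusterGF hb (by simp) (by simp)]
  have h : e = Finsupp.single 0 (e 0) + e 1 • Finsupp.single 1 1 ↔ e 2 = 0 := by
    rw [finsupp_fin_three_ext]; simp
  simp only [h]
  by_cases h2 : e 2 = 0
  · simp [h2]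
  · rw [if_neg fun h => h2 h.1]
    by_cases h3 : b ∣ e 1 ∧ b ∣ e 2
    · rw [if_pos h3, if_neg fun h4 => h2 (Nat.eq_zero_of_dvd_of_div_eq_zero h3.2 h4), map_zero,
        zero_mul]
    · rw [if_neg h3]

lemma wVar_mul_tVar : wVar * tVar =
    MvPowerSeries.monomial (Finsupp.single 1 1 + Finsupp.single 2 1 : Fin 3 →₀ ℕ) (1 : ℂ) := by
  rw [wVar, tVar, MvPowerSeries.X, MvPowerSeries.X, MvPowerSeries.monomial_mul_monomial, one_mul]

lemma clusterGF_wVar_mul_tVar_eq {b : ℕ} (hb : 0 < b) :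
    clusterGF b ((b : ℂ) • zVar) (wVar * tVar) = MvPowerSeries.subst (powVars b b b)
      (triGF fun m k => if k = m then firstOpenGF b m 0 else 0) := by
  ext e
  rw [coeff_subst_powVars_triGF _ hb, wVar_mul_tVar, coeff_clusterGF hb (by simp) (by simp)]
  have h : e = Finsupp.single 0 (e 0) + e 1 • (Finsupp.single 1 1 + Finsupp.single 2 1) ↔
      e 2 = e 1 := by
    rw [finsupp_fin_three_ext]; simp
  simp only [h]
  by_cases h2 : e 2 = e 1
  · simp [h2]
  · rw [if_neg fun h => h2 h.1]
    by_cases h3 : b ∣ e 1 ∧ b ∣ e 2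
    · rw [if_pos h3, if_neg fun h4 => h2 ((Nat.div_left_inj h3.2 h3.1).1 h4), map_zero, zero_mul]
    · rw [if_neg h3]

/-- The renewal recursion as a product of series; `h0` removes the term `j = m` missing from the
recursion. -/
lemma triGF_eq_add_mul {b : ℕ} {f r : ℕ → ℕ → PowerSeries ℂ} (h0 : ∀ k, f 0 k = 0)
    (h : ∀ m k, f m k = r m k + ∑ j ∈ range m, firstOpenGF b j 0 * f (m - j) k) :
    triGF f = triGF r + triGF f * triGF fun m k => if k = 0 then firstOpenGF b m 0 else 0 := by
  rw [triGF_mul, triGF_add]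
  congr 1
  funext m k
  rw [h m k]
  congr 1
  have h1 : ∀ p : ℕ × ℕ, ∑ q ∈ antidiagonal k, f p.1 q.1 *
      (if q.2 = 0 then firstOpenGF b p.2 0 else 0) = f p.1 k * firstOpenGF b p.2 0 := by
    intro p
    rw [sum_eq_single (k, 0)]
    · rw [if_pos rfl]
    · rintro ⟨i, j⟩ hq hne
      rw [HasAntidiagonal.mem_antidiagonal] at hq
      rw [if_neg, mul_zero]
      rintro rfl
      exact hne (by simpa using hq)
    · exact fun hn => absurd (HasAntidiagonal.mem_antidiagonal.2 (by simp)) hn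
  simp_rw [h1]
  rw [← Nat.sum_antidiagonal_swap, Nat.sum_antidiagonal_eq_sum_range_succ_mk, sum_range_succ]
  simp only [Prod.swap, Nat.sub_self, h0, zero_mul, add_zero]
  exact sum_congr rfl fun j _ => mul_comm _ _

/-- The geometric sum `(1 - t) (1 + t + ⋯ + t ^ (m - 1)) = 1 - t ^ m`, cluster by cluster. -/
lemma triGF_probe_eq (b : ℕ) :
    (triGF fun m k => if k < m then firstOpenGF b m 0 else 0) =
      (triGF fun m k => if k = 0 then firstOpenGF b m 0 else 0) -
      (triGF fun m k => if k = m then firstOpenGF b m 0 else 0) +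
      MvPowerSeries.X 2 * triGF fun m k => if k < m then firstOpenGF b m 0 else 0 := by
  ext e
  rw [map_add, map_sub, MvPowerSeries.X, MvPowerSeries.coeff_monomial_mul, one_mul]
  have hle : Finsupp.single 2 1 ≤ e ↔ 1 ≤ e 2 := by
    simp
  simp only [coeff_triGF, hle]
  have h0 : (e - Finsupp.single 2 1 : Fin 3 →₀ ℕ) 0 = e 0 := by simp
  have h1 : (e - Finsupp.single 2 1 : Fin 3 →₀ ℕ) 1 = e 1 := by simp
  have h2 : (e - Finsupp.single 2 1 : Fin 3 →₀ ℕ) 2 = e 2 - 1 := by simp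
  rw [h0, h1, h2]
  generalize e 1 = m
  generalize e 2 = k
  rcases k with _ | k
  · rcases m with _ | m
    · simp [firstOpenGF_zero]
    · simp
  · simp only [Nat.succ_ne_zero, if_false, map_zero, zero_sub, add_tsub_cancel_right,
      Nat.le_add_left, if_true]
    rcases lt_trichotomy (k + 1) m with h | h | h
    · rw [if_pos h, if_neg h.ne, if_pos (by omega)]; simp
    · rw [if_neg h.not_lt, if_pos h, if_pos (by omega)]; simp
    · rw [if_neg h.not_gt, if_neg h.ne', if_neg (by omega)]; simp

/-- A table with open last bucket is a sequence of clusters; the renewal equation at `k = 0`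
expresses this, the table without buckets giving the `1`. -/
lemma tableGF_mul_one_sub {b : ℕ} (hb : 0 < b) :
    tableGF b ((b : ℂ) • zVar) wVar * (1 - clusterGF b ((b : ℂ) • zVar) wVar) = 1 := by
  have hs := hasSubst_powVars b hb hb
  have h1 : triGF (fun m k => if k = 0 then openGF b m 0 0 else 0) = _ :=
    triGF_eq_add_mul (b := b) (r := fun m k => if k = 0 then firstOpenGF b m 0 else 0)
      (fun k => by simp [openGF_eq_zero]) fun m k => by
        rcases Nat.eq_zero_or_pos k with rfl | hk
        · simp only [if_true]
          rw [openGF_eq_sum]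
          rcases Nat.eq_zero_or_pos m with rfl | hm
          · simp [firstOpenGF_zero]
          · rw [if_pos hm]
        · simp [hk.ne']
  have h2 : (triGF fun m k => if k = 0 then (if m = 0 then 1 else openGF b m 0 0) else 0) =
      1 + triGF (fun m k => if k = 0 then openGF b m 0 0 else 0) := by
    ext e
    rw [map_add, MvPowerSeries.coeff_one, coeff_triGF, coeff_triGF]
    have he : e = 0 ↔ e 0 = 0 ∧ e 1 = 0 ∧ e 2 = 0 := by rw [finsupp_fin_three_ext]; simp
    simp only [he]
    by_cases h2 : e 2 = 0 <;> by_cases h1 : e 1 = 0 <;>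
      simp [h1, h2, openGF_eq_zero, PowerSeries.coeff_one]
  rw [tableGF_eq hb, clusterGF_wVar_eq hb, h2, ← MvPowerSeries.coe_substAlgHom hs, map_add, map_one]
  have h3 := congrArg (MvPowerSeries.substAlgHom hs) h1
  rw [map_add, map_mul] at h3
  linear_combination h3

lemma unsuccGF_mul_one_sub {b : ℕ} (hb : 0 < b) (a : (m : ℕ) → ZMod m) :
    unsuccGF b a ((b : ℂ) • zVar) wVar (tVar ^ b) * (1 - clusterGF b ((b : ℂ) • zVar) wVar) *
      (1 - tVar ^ b) =
      clusterGF b ((b : ℂ) • zVar) wVar - clusterGF b ((b : ℂ) • zVar) (wVar * tVar) := by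
  have hs := hasSubst_powVars b hb hb
  have h1 : triGF (fun m k => openGF b m k 0) = _ :=
    triGF_eq_add_mul (b := b) (r := fun m k => if k < m then firstOpenGF b m 0 else 0)
      (fun k => openGF_eq_zero (Nat.zero_le k)) fun m k => openGF_eq_sum b m k 0
  have h2 := congrArg (MvPowerSeries.substAlgHom hs) (triGF_probe_eq b)
  have h3 := congrArg (MvPowerSeries.substAlgHom hs) h1
  rw [map_add, map_mul] at h3
  rw [map_add, map_sub, map_mul, MvPowerSeries.substAlgHom_X] at h2
  have h4 : powVars (b : ℂ) b b 2 = tVar ^ b := by rw [powVars_eq]; rfl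
  rw [h4] at h2
  rw [unsuccGF_eq hb, clusterGF_wVar_eq hb, clusterGF_wVar_mul_tVar_eq hb,
    ← MvPowerSeries.coe_substAlgHom hs]
  linear_combination (1 - tVar ^ b) * h3 + h2

/-! ### The product formula -/

lemma variable_ne_zero (s : Fin 3) : (MvPowerSeries.X s : GFRing) ≠ 0 := by
  intro h
  have := congrArg (MvPowerSeries.coeff (Finsupp.single s 1)) h
  simp [MvPowerSeries.coeff_X] at this

lemma subst_smul_eq {x : GFRing} (hx : PowerSeries.HasSubst x) (c : ℂ) (f : PowerSeries ℂ) :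
    PowerSeries.subst (c • x) f = PowerSeries.subst x (PowerSeries.rescale c f) := by
  rw [PowerSeries.rescale_eq_subst, PowerSeries.subst_comp_subst_apply
    (PowerSeries.HasSubst.smul_X' c) hx, PowerSeries.subst_smul hx, PowerSeries.subst_X hx]

lemma rescale_treeSeries (ζ : ℂ) :
    PowerSeries.rescale ζ treeSeries = PowerSeries.X * twistedTree ζ := by
  rw [treeSeries_eq, map_mul, PowerSeries.rescale_X, twistedTree]
  ring

lemma treeProd_eq {b : ℕ} (hb : 0 < b) {y : GFRing} (hy : y ≠ 0) :
    treeProd b (zVar * y) = 1 - toField (clusterGF b ((b : ℂ) • zVar) y) := by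
  have hx : PowerSeries.HasSubst (zVar * y) :=
    PowerSeries.HasSubst.of_constantCoeff_zero (by simp [zVar])
  have hz0 : toField zVar ≠ 0 := by
    rw [toField, Ne, FaithfulSMul.algebraMap_eq_zero_iff]
    exact variable_ne_zero 0
  have hy0 : toField y ≠ 0 := by
    rwa [toField, Ne, FaithfulSMul.algebraMap_eq_zero_iff]
  let Φ : PowerSeries ℂ →+* GFField :=
    (algebraMap GFRing GFField).comp (PowerSeries.substAlgHom (R := ℂ) hx).toRingHom
  have hΦ : ∀ f, Φ f = toField (PowerSeries.subst (zVar * y) f) := fun f => by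
    rw [← PowerSeries.coe_substAlgHom hx]; rfl
  have hT : ∀ ζ : ℂ, 1 - toField (treeFn (ζ • (zVar * y))) / toField zVar =
      toField y * ((toField y)⁻¹ - Φ (twistedTree ζ)) := by
    intro ζ
    have h1 : treeFn (ζ • (zVar * y)) = zVar * y * PowerSeries.subst (zVar * y) (twistedTree ζ) := by
      change PowerSeries.subst _ treeSeries = _
      rw [subst_smul_eq hx, rescale_treeSeries, PowerSeries.subst_mul hx, PowerSeries.subst_X hx]
    have h2 : toField (treeFn (ζ • (zVar * y))) = toField zVar * toField y * Φ (twistedTree ζ) := by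
      rw [h1, hΦ]; simp only [toField, map_mul]
    rw [h2]
    field_simp
  have hF : ∀ d, toField (almostFullGF b d (((b : ℂ) • zVar) * y)) = Φ (scaledAlmostFull b d) := by
    intro d
    rw [hΦ, almostFullGF, smul_mul_assoc, subst_smul_eq hx]
    rfl
  -- Evaluating at `1 / y` and multiplying by `y ^ b`, one factor `y` per root, turns each linear
  -- factor into `1 - T(ω ^ j z y) / z`.
  have hP := congrArg (fun p => (p.map Φ).eval (toField y)⁻¹) (cluster_polynomial_eq_prod hb)
  simp only [Polynomial.map_sub, Polynomial.map_pow, Polynomial.map_X, Polynomial.map_sum,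
    Polynomial.map_mul, Polynomial.map_C, Polynomial.map_prod, Polynomial.eval_sub,
    Polynomial.eval_pow, Polynomial.eval_X, Polynomial.eval_finsetSum, Polynomial.eval_mul,
    Polynomial.eval_C, Polynomial.eval_prod] at hP
  rw [treeProd, prod_congr rfl fun j _ => hT (omegaRoot b ^ j), prod_mul_distrib, prod_const,
    card_range, ← hP, mul_sub, ← mul_pow, mul_inv_cancel₀ hy0, one_pow, mul_sum]
  congr 1
  simp only [clusterGF, toField, map_sum, map_mul, map_pow]
  refine sum_congr rfl fun d hd => ?_
  have hF' := hF d
  simp only [toField] at hF' hy0 ⊢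
  rw [hF']
  have hd' := mem_range.1 hd
  rw [show (algebraMap GFRing GFField y) ^ b =
    (algebraMap GFRing GFField y) ^ (b - d) * (algebraMap GFRing GFField y) ^ d by
      rw [← pow_add, Nat.sub_add_cancel hd'.le], inv_pow]
  field_simp

theorem mainTheorem10 (b : ℕ) (hb : 1 ≤ b) (a : (m : ℕ) → ZMod m) :
    toField (unsuccGF b a ((b : ℂ) • zVar) wVar (tVar ^ b)) =
        toField (tableGF b ((b : ℂ) • zVar) wVar) *
          ((toField (clusterGF b ((b : ℂ) • zVar) wVar) -
              toField (clusterGF b ((b : ℂ) • zVar) (wVar * tVar))) /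
            (1 - toField (tVar ^ b))) ∧
    toField (unsuccGF b a ((b : ℂ) • zVar) wVar (tVar ^ b)) =
        (treeProd b (zVar * wVar * tVar) - treeProd b (zVar * wVar)) /
          ((1 - toField (tVar ^ b)) * treeProd b (zVar * wVar)) := by
  have hw : wVar ≠ 0 := variable_ne_zero 1
  have ht : tVar ≠ 0 := variable_ne_zero 2
  rw [mul_assoc zVar, treeProd_eq hb hw, treeProd_eq hb (mul_ne_zero hw ht)]
  have h1 := congrArg toField (tableGF_mul_one_sub hb)
  have h2 := congrArg toField (unsuccGF_mul_one_sub hb a)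
  have hq : (1 : GFField) - toField (tVar ^ b) ≠ 0 := by
    have h : (1 : GFRing) - tVar ^ b ≠ 0 := by
      intro h
      have := congrArg MvPowerSeries.constantCoeff h
      simp [tVar, (Nat.pos_of_ne_zero (by omega) : 0 < b).ne'] at this
    rw [toField, ← map_one (algebraMap GFRing GFField), ← map_sub, Ne,
      FaithfulSMul.algebraMap_eq_zero_iff]
    exact h
  simp only [toField, map_mul, map_sub, map_one] at h1 h2 hq ⊢
  -- `Λ₀` is an inverse of `1 - N₀`, so the denominator of the second formula is nonzero.
  have hN : (1 : GFField) - algebraMap GFRing GFField (clusterGF b ((b : ℂ) • zVar) wVar) ≠ 0 :=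
    right_ne_zero_of_mul_eq_one h1
  constructor
  · rw [← mul_div_assoc, eq_div_iff hq, ← h2]
    linear_combination (-(algebraMap GFRing GFField
      (unsuccGF b a ((b : ℂ) • zVar) wVar (tVar ^ b))) *
      (1 - algebraMap GFRing GFField (tVar ^ b))) * h1
  · rw [eq_div_iff (mul_ne_zero hq hN)]
    linear_combination h2
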